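/- Fix an integer $d\ge 2$. **Loops.** Let $E$ be the set of directed nearest-neighbour edges $e=(u(e),v(e))$ of $\mathbb Z^d$, $e^{-1}$ the reversed edge, and $E^+$ the set of edges with $v(e)>u(e)$ in the lexicographic order. A closed path is a sequence $e_1\cdots e_n$ of edges ($n=0$ allowed) with $v(e_i)=u(e_{i+1})$, indices mod $n$; it has a backtrack at $i$ if $e_{i+1}=e_i^{-1}$, indices mod $n$. A loop is a class, modulo cyclic rotation, of closed paths without backtracks; the empty one is the null loop $\emptyset$. The core $[\rho]$ of a closed path $\rho$ is the loop obtained from $\rho$ by successively erasing backtracks (it is unique). A loop sequence is a finite sequence of loops modulo insertion and deletion of null loops; $\mathcal S$ is the set of loop sequences, and the minimal representation of $s\in\mathcal S$ is its representative $(l_1,\ldots,l_n)$ without null loops; $|s|:=|l_1|+\cdots+|l_n|$ is the total number of edges; the null loop sequence $\emptyset$ has $|\emptyset|=0$. Let $\mathcal P^+$ be the set of closed paths $p=e_1e_2e_3e_4$ without backtracks such that $u(e_1)$ is the lexicographically smallest and $v(e_1)$ the second smallest vertex of $p$; $\mathcal P^+(e)$ is the set of $p\in\mathcal P^+$ containing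 $e$ or $e^{-1}$. **Operations.** Fix a rule that chooses a first edge of every non-null loop; then the loop is written as a path and its edges are numbered by locations. For locations $x<y$ of $l$: if $l=aebec$ with $e$ at $x$ and $y$, put $\times^1_{x,y}l=[aec]$, $\times^2_{x,y}l=[be]$; if $l=aebe^{-1}c$ with $e$ at $x$ and $e^{-1}$ at $y$, put $\times^1_{x,y}l=[ac]$, $\times^2_{x,y}l=[b]$; in both cases $\times^1_{y,x}l=\times^2_{x,y}l$ and $\times^2_{y,x}l=\times^1_{x,y}l$. If $l=aeb$ with $e$ at $x$ and $p\in\mathcal P^+(e)$, put $l\oplus_xp=[aedceb]$, $l\ominus_xp=[ac^{-1}d^{-1}b]$ when $p=ced$, and $l\oplus_xp=[aec^{-1}d^{-1}eb]$, $l\ominus_xp=[adcb]$ when $p=ce^{-1}d$. **Limiting master loop equation.** A function $\phi:\mathcal S\to\mathbb R$ satisfies it at $\beta\in\mathbb R$ if for every non-null loop sequence $s$ with minimal representation $(l_1,\ldots,l_n)$, with $e$ the first edge of $l_1$, $A$ and $B$ the sets of locations in $l_1$ of $e$ and of $e^{-1}$, $C=A\cup B$, and $m=|C|$, $$\begin{aligned}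 m\,\phi(s)={}&\sum_{x\in A,\,y\in B}\phi(\times^1_{x,y}l_1,\times^2_{x,y}l_1,l_2,\ldots,l_n)+\sum_{x\in B,\,y\in A}\phi(\times^1_{x,y}l_1,\times^2_{x,y}l_1,l_2,\ldots,l_n)\\&-\sum_{\substack{x,y\in A\\x\ne y}}\phi(\times^1_{x,y}l_1,\times^2_{x,y}l_1,l_2,\ldots,l_n)-\sum_{\substack{x,y\in B\\x\ne y}}\phi(\times^1_{x,y}l_1,\times^2_{x,y}l_1,l_2,\ldots,l_n)\\&+\beta\sum_{p\in\mathcal P^+(e)}\sum_{x\in C}\phi(l_1\ominus_xp,l_2,\ldots,l_n)-\beta\sum_{p\in\mathcal P^+(e)}\sum_{x\in C}\phi(l_1\oplus_xp,l_2,\ldots,l_n).\end{aligned}$$ **Gauge theory.** For a finite $\Lambda\subseteq\mathbb Z^d$, let $E^+_\Lambda$ and $\mathcal P^+_\Lambda$ be the elements of $E^+$ and $\mathcal P^+$ with all vertices in $\Lambda$. Let $\mu_{\Lambda,N,\beta}$ be the probability measure on $SO(N)^{E^+_\Lambda}$ with density proportional to $\exp\bigl(N\beta\sum_{p\in\mathcal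 P^+_\Lambda}W_p\bigr)$ with respect to the product of the Haar probability measures, where $W_{e_1\cdots e_k}=\operatorname{Tr}(Q_{e_1}\cdots Q_{e_k})$ and $Q_{e^{-1}}=Q_e^{-1}$. For a loop sequence $s$ contained in $\Lambda$ with minimal representation $(l_1,\ldots,l_n)$ put $\phi_{\Lambda,N,\beta}(s)=N^{-n}\int W_{l_1}\cdots W_{l_n}\,d\mu_{\Lambda,N,\beta}$. **Theorem.** (1) For every real $L\ge1$ there is $\beta_0(L,d)>0$ such that, for every real $\beta$ with $|\beta|\le\beta_0(L,d)$ and for every first-edge rule, there is a unique function $\phi_\beta:\mathcal S\to\mathbb R$ such that (a) $\phi_\beta(\emptyset)=1$, (b) $|\phi_\beta(s)|\le L^{|s|}$ for all $s\in\mathcal S$, and (c) $\phi_\beta$ satisfies the limiting master loop equation at $\beta$. (2) There is $\beta_0(d)>0$ such that, for every real $\beta$ with $|\beta|\le\beta_0(d)$, there is a function $\phi_\beta:\mathcal S\to\mathbb R$ that satisfies (a), (b) with $L=1$, and (c), for every first-edge rule, and such that for every sequence of finite sets $\Lambda_1\subseteq\Lambda_2\subseteq\cdots$ with union $\mathbb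 Z^d$ and every $s\in\mathcal S$, $\phi_{\Lambda_N,N,\beta}(s)\to\phi_\beta(s)$ as $N\to\infty$. -/

import Mathlib

open Filter Topology MeasureTheory

namespace LatticeGauge

/-! ### Edges, closed paths, loops -/

/-- Directed nearest neighbour edges of `ℤ^d`, from `src` to `tgt`. -/
@[ext] structure Edge (d : ℕ) where
  src : Fin d → ℤ
  tgt : Fin d → ℤ
  adj : ∑ i, |tgt i - src i| = 1

noncomputable instance (d : ℕ) : DecidableEq (Edge d) := Classical.decEq _

variable {d : ℕ}

/-- The reversed edge. -/
def Edge.inv (e : Edge d) : Edge d where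
  src := e.tgt
  tgt := e.src
  adj := by simpa only [abs_sub_comm] using e.adj

@[simp] theorem Edge.inv_src (e : Edge d) : e.inv.src = e.tgt := rfl
@[simp] theorem Edge.inv_tgt (e : Edge d) : e.inv.tgt = e.src := rfl
@[simp] theorem Edge.inv_inv (e : Edge d) : e.inv.inv = e := rfl

/-- An edge is positively oriented if its end is larger than its beginning in the lexicographic
order of `ℤ^d`. -/
def Edge.IsPos (e : Edge d) : Prop := toLex e.src < toLex e.tgt

/-- The list of edges `ρ` is a closed path: each edge ends where the next one begins, cyclically.
The null path is closed. -/
def IsClosedPath (ρ : List (Edge d)) : Prop :=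
  (ρ : Cycle (Edge d)).Chain (fun e f => e.tgt = f.src)

/-- The closed path `ρ` has no backtracks, neither interior nor terminal. -/
def IsNonbacktracking (ρ : List (Edge d)) : Prop :=
  (ρ : Cycle (Edge d)).Chain (fun e f => f ≠ e.inv)

/-- A loop is a nonbacktracking cycle: a cyclic equivalence class of closed paths that have no
backtracks. -/
def Loop (d : ℕ) : Type :=
  {c : Cycle (Edge d) //
    c.Chain (fun e f => e.tgt = f.src) ∧ c.Chain (fun e f => f ≠ e.inv)}

/-- The null loop. -/
def Loop.null : Loop d := ⟨Cycle.nil, Cycle.Chain.nil _, Cycle.Chain.nil _⟩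

/-- The length of a loop. -/
def Loop.length (l : Loop d) : ℕ := l.1.length

/-- The inverse path. -/
def invPath (ρ : List (Edge d)) : List (Edge d) := (ρ.map Edge.inv).reverse

/-- `Erase ρ ρ'`: the path `ρ'` is obtained from `ρ` by erasing one backtrack, either an interior
one or the terminal one. -/
inductive Erase : List (Edge d) → List (Edge d) → Prop
  | interior (a b : List (Edge d)) (e : Edge d) : Erase (a ++ e :: e.inv :: b) (a ++ b)
  | terminal (b : List (Edge d)) (e : Edge d) : Erase (e :: (b ++ [e.inv])) b

/-- `l` is a nonbacktracking core of the closed path `ρ`: it is the class of a path that is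
obtained from `ρ` by successive backtrack erasures. -/
def IsCore (ρ : List (Edge d)) (l : Loop d) : Prop :=
  ∃ ρ' : List (Edge d), Relation.ReflTransGen Erase ρ ρ' ∧ l.1 = (ρ' : Cycle (Edge d))

theorem Erase.length_lt {ρ ρ' : List (Edge d)} (h : Erase ρ ρ') : ρ'.length < ρ.length := by
  cases h <;> simp only [List.length_append, List.length_cons, List.length_nil] <;> omega

theorem isClosedPath_append {a b : List (Edge d)} :
    IsClosedPath (a ++ b) ↔ IsClosedPath (b ++ a) := by
  have h : ((a ++ b : List (Edge d)) : Cycle (Edge d)) = ((b ++ a : List (Edge d)) : Cycle _) :=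
    Cycle.coe_eq_coe.mpr List.isRotated_append
  unfold IsClosedPath
  rw [h]

theorem isClosedPath_erase_head {e : Edge d} {b : List (Edge d)}
    (h : IsClosedPath (e :: e.inv :: b)) : IsClosedPath b := by
  unfold IsClosedPath at *
  rw [Cycle.chain_coe_cons] at h
  cases b with
  | nil => exact Cycle.Chain.nil _
  | cons f t =>
    rw [Cycle.chain_coe_cons]
    simp only [List.cons_append, List.isChain_cons_cons, Edge.inv_src, Edge.inv_tgt] at h ⊢
    obtain ⟨-, h2, h3⟩ := h
    rw [← List.cons_append] at h3 ⊢
    rw [List.isChain_append] at h3 ⊢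
    refine ⟨h3.1, List.isChain_singleton _, ?_⟩
    intro x hx y hy
    have := h3.2.2 x hx e (by simp)
    simp only [List.head?_cons, Option.mem_def, Option.some.injEq] at hy
    rw [this, h2, hy]

theorem Erase.isClosedPath {ρ ρ' : List (Edge d)} (h : Erase ρ ρ') (hρ : IsClosedPath ρ) :
    IsClosedPath ρ' := by
  cases h with
  | interior a b e =>
    rw [isClosedPath_append] at hρ ⊢
    exact isClosedPath_erase_head (by simpa using hρ)
  | terminal b e =>
    rw [← List.cons_append, isClosedPath_append] at hρ
    exact isClosedPath_erase_head (e := e.inv) (by simpa using hρ)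

theorem exists_not_of_not_isChain {α : Type*} {r : α → α → Prop} :
    ∀ {l : List α}, ¬ l.IsChain r → ∃ u x y v, l = u ++ x :: y :: v ∧ ¬ r x y
  | [], h => (h List.isChain_nil).elim
  | [_], h => (h (List.isChain_singleton _)).elim
  | x :: y :: v, h => by
    rw [List.isChain_cons_cons] at h
    by_cases hr : r x y
    · obtain ⟨u, x', y', v', h1, h2⟩ := exists_not_of_not_isChain (fun h' => h ⟨hr, h'⟩)
      exact ⟨x :: u, x', y', v', by rw [h1]; rfl, h2⟩
    · exact ⟨[], x, y, v, rfl, hr⟩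

theorem exists_erase {ρ : List (Edge d)} (h : ¬ IsNonbacktracking ρ) : ∃ ρ', Erase ρ ρ' := by
  unfold IsNonbacktracking at h
  cases ρ with
  | nil => exact (h (Cycle.Chain.nil _)).elim
  | cons a t =>
    rw [Cycle.chain_coe_cons] at h
    obtain ⟨u, x, y, v, h1, h2⟩ := exists_not_of_not_isChain h
    rw [not_not] at h2
    subst h2
    rcases List.eq_nil_or_concat v with rfl | ⟨v', z, rfl⟩
    · have h3 : (a :: t) ++ [a] = (u ++ [x]) ++ [x.inv] := by simpa using h1
      obtain ⟨h4, h5⟩ := List.append_inj' h3 rfl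
      cases u with
      | nil =>
        simp only [List.nil_append, List.cons.injEq] at h4 h5
        have h6 : x = x.inv := h4.1.symm.trans h5.1
        have h7 := x.adj
        have h8 : x.src = x.tgt := congrArg Edge.src h6
        simp [h8] at h7
      | cons w u' =>
        simp only [List.cons_append, List.cons.injEq] at h4 h5
        refine ⟨u', ?_⟩
        have := Erase.terminal u' a
        rw [h5.1] at this
        rw [h4.2, h5.1]
        simpa using this
    · have h3 : (a :: t) ++ [a] = (u ++ x :: x.inv :: v') ++ [z] := by simpa using h1
      obtain ⟨h4, -⟩ := List.append_inj' h3 rfl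
      exact ⟨_, h4 ▸ Erase.interior u v' x⟩

/-- Every closed path has a nonbacktracking core. -/
theorem exists_core : ∀ (n : ℕ) (ρ : List (Edge d)), ρ.length = n → IsClosedPath ρ →
    ∃ l : Loop d, IsCore ρ l := by
  intro n
  induction n using Nat.strong_induction_on with
  | _ n ih =>
    intro ρ hn hρ
    by_cases h : IsNonbacktracking ρ
    · exact ⟨⟨ρ, hρ, h⟩, ρ, Relation.ReflTransGen.refl, rfl⟩
    · obtain ⟨ρ', h'⟩ := exists_erase h
      obtain ⟨l, ρ'', h1, h2⟩ := ih _ (hn ▸ h'.length_lt) ρ' rfl (h'.isClosedPath hρ)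
      exact ⟨l, ρ'', Relation.ReflTransGen.head h' h1, h2⟩

open Classical in
/-- The nonbacktracking core `[ρ]` of a closed path `ρ`. It is unique; it is only ever taken of
closed paths (the value elsewhere is a dummy). -/
noncomputable def core (ρ : List (Edge d)) : Loop d :=
  if h : IsClosedPath ρ then (exists_core ρ.length ρ rfl h).choose else Loop.null

/-! ### Loop sequences -/

open Classical in
/-- The list of loops with its null loops deleted. -/
noncomputable def dropNull (s : List (Loop d)) : List (Loop d) :=
  s.filter (fun l => l ≠ Loop.null)

/-- Two finite sequences of loops are equivalent if they differ by inserting and deleting null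
loops, that is, if they agree after all null loops are deleted. -/
noncomputable def loopSeqSetoid (d : ℕ) : Setoid (List (Loop d)) := Setoid.ker dropNull

/-- Loop sequences: equivalence classes of finite sequences of loops. -/
def LoopSeq (d : ℕ) : Type := Quotient (loopSeqSetoid d)

/-- The loop sequence represented by a finite sequence of loops, null loops allowed. -/
noncomputable def LoopSeq.mk (s : List (Loop d)) : LoopSeq d := Quotient.mk (loopSeqSetoid d) s

/-- The null loop sequence. -/
noncomputable def LoopSeq.null : LoopSeq d := LoopSeq.mk [Loop.null]

/-- The minimal representation of a loop sequence: the representative without null loops. -/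
noncomputable def LoopSeq.minRep (s : LoopSeq d) : List (Loop d) :=
  Quotient.lift dropNull (fun _ _ h => Setoid.ker_def.mp h) s

/-- The length `|s|` of a loop sequence. -/
noncomputable def LoopSeq.length (s : LoopSeq d) : ℕ := (s.minRep.map Loop.length).sum

/-! ### Plaquettes -/

/-- Positively oriented plaquettes: nonbacktracking closed paths `e₁e₂e₃e₄` such that `u(e₁)` is
the lexicographically smallest vertex and `v(e₁)` is the second smallest one. (Every vertex of a
closed path is the beginning of one of its edges.) -/
def IsPosPlaquette (p : List (Edge d)) : Prop :=
  IsClosedPath p ∧ IsNonbacktracking p ∧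
    ∃ e₁ e₂ e₃ e₄ : Edge d, p = [e₁, e₂, e₃, e₄] ∧
      (∀ f ∈ p, toLex e₁.src ≤ toLex f.src) ∧
      (∀ f ∈ p, f.src ≠ e₁.src → toLex e₁.tgt ≤ toLex f.src)

theorem finite_edges (Λ : Finset (Fin d → ℤ)) :
    {e : Edge d | e.src ∈ Λ ∧ e.tgt ∈ Λ}.Finite := by
  refine Set.Finite.of_finite_image (f := fun e : Edge d => (e.src, e.tgt))
    (((Λ ×ˢ Λ : Finset _).finite_toSet).subset ?_) ?_
  · rintro _ ⟨e, he, rfl⟩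
    simpa using he
  · intro e _ f _ h
    simp only [Prod.mk.injEq] at h
    exact Edge.ext h.1 h.2

theorem finite_paths (Λ : Finset (Fin d → ℤ)) (n : ℕ) :
    {p : List (Edge d) | p.length = n ∧ ∀ f ∈ p, f.src ∈ Λ ∧ f.tgt ∈ Λ}.Finite := by
  have : Finite {e : Edge d | e.src ∈ Λ ∧ e.tgt ∈ Λ} := finite_edges Λ
  refine ((List.finite_length_eq {e : Edge d | e.src ∈ Λ ∧ e.tgt ∈ Λ} n).image
    (List.map Subtype.val)).subset ?_
  rintro p ⟨h1, h2⟩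
  refine ⟨p.attach.map (fun f => ⟨f.1, h2 f.1 f.2⟩), by
    change (List.map _ _).length = n
    simpa using h1, ?_⟩
  simp [List.map_map, Function.comp_def]

theorem Edge.abs_sub_le (e : Edge d) (i : Fin d) : |e.tgt i - e.src i| ≤ 1 := by
  rw [← e.adj]
  exact Finset.single_le_sum (f := fun i => |e.tgt i - e.src i|) (fun _ _ => abs_nonneg _)
    (Finset.mem_univ i)

theorem finite_plaquettesIn (Λ : Finset (Fin d → ℤ)) :
    {p : List (Edge d) | IsPosPlaquette p ∧ ∀ f ∈ p, f.src ∈ Λ ∧ f.tgt ∈ Λ}.Finite := by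
  refine (finite_paths Λ 4).subset ?_
  rintro p ⟨⟨-, -, e₁, e₂, e₃, e₄, rfl, -⟩, h⟩
  exact ⟨rfl, h⟩

theorem finite_plaquettesAt (e : Edge d) :
    {p : List (Edge d) | IsPosPlaquette p ∧ (e ∈ p ∨ e.inv ∈ p)}.Finite := by
  refine (finite_plaquettesIn (Finset.Icc (fun i => e.src i - 5) (fun i => e.src i + 5))).subset ?_
  rintro p ⟨hp, he⟩
  refine ⟨hp, ?_⟩
  obtain ⟨hc, -, e₁, e₂, e₃, e₄, rfl, -⟩ := hp
  have hc' : e₁.tgt = e₂.src ∧ e₂.tgt = e₃.src ∧ e₃.tgt = e₄.src ∧ e₄.tgt = e₁.src := by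
    unfold IsClosedPath at hc
    rw [Cycle.chain_coe_cons] at hc
    simpa using hc
  obtain ⟨c1, c2, c3, c4⟩ := hc'
  have key : ∀ i, ∃ z : ℤ, (z = e.src i ∨ z = e.tgt i) ∧
      (z = e₁.src i ∨ z = e₂.src i ∨ z = e₃.src i ∨ z = e₄.src i) := by
    intro i
    rcases he with he | he
    · simp only [List.mem_cons, List.not_mem_nil, or_false] at he
      exact ⟨e.src i, Or.inl rfl, by rcases he with h | h | h | h <;> simp [h]⟩
    · simp only [List.mem_cons, List.not_mem_nil, or_false] at he
      exact ⟨e.tgt i, Or.inr rfl, by rcases he with h | h | h | h <;> simp [← h]⟩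
  have bound : ∀ f ∈ [e₁, e₂, e₃, e₄], ∀ i,
      (e.src i - 5 ≤ f.src i ∧ f.src i ≤ e.src i + 5) ∧
      (e.src i - 5 ≤ f.tgt i ∧ f.tgt i ≤ e.src i + 5) := by
    intro f hf i
    obtain ⟨z, h1, h2⟩ := key i
    have b0 := abs_le.mp (e.abs_sub_le i)
    have b1 := abs_le.mp (e₁.abs_sub_le i)
    have b2 := abs_le.mp (e₂.abs_sub_le i)
    have b3 := abs_le.mp (e₃.abs_sub_le i)
    have b4 := abs_le.mp (e₄.abs_sub_le i)
    have d1 := congrFun c1 i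
    have d2 := congrFun c2 i
    have d3 := congrFun c3 i
    have d4 := congrFun c4 i
    simp only [List.mem_cons, List.not_mem_nil, or_false] at hf
    rcases hf with rfl | rfl | rfl | rfl <;> refine ⟨⟨?_, ?_⟩, ?_, ?_⟩ <;> omega
  intro f hf
  simp only [Finset.mem_Icc, Pi.le_def]
  exact ⟨⟨fun i => (bound f hf i).1.1, fun i => (bound f hf i).1.2⟩,
    ⟨fun i => (bound f hf i).2.1, fun i => (bound f hf i).2.2⟩⟩

/-- `𝒫⁺_Λ`, the positively oriented plaquettes all of whose vertices are in `Λ`. -/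
noncomputable def plaquettesIn (Λ : Finset (Fin d → ℤ)) : Finset (List (Edge d)) :=
  (finite_plaquettesIn Λ).toFinset

/-- `𝒫⁺(e)`, the positively oriented plaquettes that contain `e` or its inverse. -/
noncomputable def plaquettesAt (e : Edge d) : Finset (List (Edge d)) :=
  (finite_plaquettesAt e).toFinset

/-! ### Operations on loops

A loop is given by one of the closed paths `ρ` in its class; locations are numbered from `0`. -/

/-- The part of the path strictly before location `x`. -/
def before (ρ : List (Edge d)) (x : ℕ) : List (Edge d) := ρ.take x

/-- The part of the path strictly after location `x`. -/
def after (ρ : List (Edge d)) (x : ℕ) : List (Edge d) := ρ.drop (x + 1)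

/-- The part of the path strictly between the locations `x < y`. -/
def between (ρ : List (Edge d)) (x y : ℕ) : List (Edge d) := (ρ.take y).drop (x + 1)

/-- The pair of loops `[aec], [be]` for a path `ρ = aebec` with the two `e`'s at the locations `x < y`;
splitting at `y, x` gives the same two loops in reverse order. -/
noncomputable def posSplit (ρ : List (Edge d)) (e : Edge d) (x y : ℕ) : Loop d × Loop d :=
  if x < y then (core (before ρ x ++ e :: after ρ y), core (between ρ x y ++ [e]))
  else (core (between ρ y x ++ [e]), core (before ρ y ++ e :: after ρ x))

/-- The pair of loops `[ac], [b]` for a path `ρ = aebe⁻¹c` with `e`, `e⁻¹` at the locations `x < y`;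
splitting at `y, x` gives the same two loops in reverse order. -/
noncomputable def negSplit (ρ : List (Edge d)) (x y : ℕ) : Loop d × Loop d :=
  if x < y then (core (before ρ x ++ after ρ y), core (between ρ x y))
  else (core (between ρ y x), core (before ρ y ++ after ρ x))

/-- The positive merger of `ρ = aeb`, with `e` at location `x`, and `ρ'` at location `y`: it is
`[aedceb]` if `ρ' = ced`, and `[aec⁻¹d⁻¹eb]` if `ρ' = ce⁻¹d`. -/
noncomputable def posMerge (ρ : List (Edge d)) (e : Edge d) (x : ℕ) (ρ' : List (Edge d)) (y : ℕ) :
    Loop d :=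
  if ρ'[y]? = some e then
    core (before ρ x ++ [e] ++ after ρ' y ++ before ρ' y ++ [e] ++ after ρ x)
  else
    core (before ρ x ++ [e] ++ invPath (before ρ' y) ++ invPath (after ρ' y) ++ [e] ++ after ρ x)

/-- The negative merger of `ρ = aeb`, with `e` at location `x`, and `ρ'` at location `y`: it is
`[ac⁻¹d⁻¹b]` if `ρ' = ced`, and `[adcb]` if `ρ' = ce⁻¹d`. -/
noncomputable def negMerge (ρ : List (Edge d)) (e : Edge d) (x : ℕ) (ρ' : List (Edge d)) (y : ℕ) :
    Loop d :=
  if ρ'[y]? = some e then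
    core (before ρ x ++ invPath (before ρ' y) ++ invPath (after ρ' y) ++ after ρ x)
  else
    core (before ρ x ++ after ρ' y ++ before ρ' y ++ after ρ x)

/-- The location in a plaquette `p` at which `e` or its inverse occurs. -/
noncomputable def locIn (p : List (Edge d)) (e : Edge d) : ℕ :=
  p.findIdx (fun f => decide (f = e ∨ f = e.inv))

/-- The positive deformation `ρ ⊕ₓ p`, where `e` is the edge of `ρ` at location `x`. -/
noncomputable def posDeform (ρ : List (Edge d)) (e : Edge d) (x : ℕ) (p : List (Edge d)) :
    Loop d :=
  posMerge ρ e x p (locIn p e)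

/-- The negative deformation `ρ ⊖ₓ p`, where `e` is the edge of `ρ` at location `x`. -/
noncomputable def negDeform (ρ : List (Edge d)) (e : Edge d) (x : ℕ) (p : List (Edge d)) :
    Loop d :=
  negMerge ρ e x p (locIn p e)

/-! ### The master loop equation in the 't Hooft limit -/

/-- A rule that fixes the first edge of every loop, and thereby all its locations: it picks one of
the closed paths in the class. -/
structure FirstEdgeRule (d : ℕ) where
  path : Loop d → List (Edge d)
  path_mem : ∀ l, (path l : Cycle (Edge d)) = l.1

/-- The set of locations in `ρ` where the edge `e` occurs. -/
noncomputable def locs (ρ : List (Edge d)) (e : Edge d) : Finset ℕ :=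
  (Finset.range ρ.length).filter (fun x => ρ[x]? = some e)

/-- The splitting term for the loop sequence `(l₁, l₂, …, lₙ)`, where `ρ` is the closed path
representing `l₁` and `ls = (l₂, …, lₙ)`. -/
noncomputable def splittingTerm (φ : LoopSeq d → ℝ) (ρ : List (Edge d)) (e : Edge d)
    (ls : List (Loop d)) : ℝ :=
  let A := locs ρ e
  let B := locs ρ e.inv
  (∑ x ∈ A, ∑ y ∈ B, φ (.mk ((negSplit ρ x y).1 :: (negSplit ρ x y).2 :: ls)))
    + (∑ x ∈ B, ∑ y ∈ A, φ (.mk ((negSplit ρ x y).1 :: (negSplit ρ x y).2 :: ls)))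
    - (∑ x ∈ A, ∑ y ∈ A.erase x, φ (.mk ((posSplit ρ e x y).1 :: (posSplit ρ e x y).2 :: ls)))
    - (∑ x ∈ B, ∑ y ∈ B.erase x,
        φ (.mk ((posSplit ρ e.inv x y).1 :: (posSplit ρ e.inv x y).2 :: ls)))

/-- The deformation term. At a location in `A` the deformed edge is `e`, at a location in `B` it
is `e⁻¹`; the sums over `A` and over `B` together make the sum over `C = A ∪ B`. -/
noncomputable def deformationTerm (β : ℝ) (φ : LoopSeq d → ℝ) (ρ : List (Edge d)) (e : Edge d)
    (ls : List (Loop d)) : ℝ :=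
  let A := locs ρ e
  let B := locs ρ e.inv
  β * (∑ p ∈ plaquettesAt e,
      ((∑ x ∈ A, φ (.mk (negDeform ρ e x p :: ls)))
        + ∑ x ∈ B, φ (.mk (negDeform ρ e.inv x p :: ls))))
    - β * (∑ p ∈ plaquettesAt e,
      ((∑ x ∈ A, φ (.mk (posDeform ρ e x p :: ls)))
        + ∑ x ∈ B, φ (.mk (posDeform ρ e.inv x p :: ls))))

/-- The master loop equation in the 't Hooft limit: for every non-null loop sequence with minimal
representation `(l₁, …, lₙ)`, where `e` is the first edge of `l₁`. -/
def MasterLoopEq (R : FirstEdgeRule d) (β : ℝ) (φ : LoopSeq d → ℝ) : Prop :=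
  ∀ (s : LoopSeq d) (l₁ : Loop d) (ls : List (Loop d)), s.minRep = l₁ :: ls →
    ∀ (e : Edge d) (τ : List (Edge d)), R.path l₁ = e :: τ →
      ((locs (R.path l₁) e ∪ locs (R.path l₁) e.inv).card : ℝ) * φ s =
        splittingTerm φ (R.path l₁) e ls + deformationTerm β φ (R.path l₁) e ls

/-- `φ(∅) = 1`, `|φ(s)| ≤ L^|s|` for all `s`, and `φ` satisfies the master loop equation. -/
structure IsMasterSolution (R : FirstEdgeRule d) (L β : ℝ) (φ : LoopSeq d → ℝ) : Prop where
  null : φ LoopSeq.null = 1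
  bound : ∀ s, |φ s| ≤ L ^ s.length
  master : MasterLoopEq R β φ

/-! ### `SO(N)` lattice gauge theory on a finite set `Λ` -/

/-- The group `SO(N)`. -/
abbrev SO (N : ℕ) : Type := Matrix.specialOrthogonalGroup (Fin N) ℝ

instance (N : ℕ) : MeasurableSpace (SO N) := borel _

instance (N : ℕ) : BorelSpace (SO N) := ⟨rfl⟩

theorem SO.coe_inv {N : ℕ} (A : SO N) :
    ((A⁻¹ : SO N) : Matrix (Fin N) (Fin N) ℝ) = star (A : Matrix (Fin N) (Fin N) ℝ) := rfl

instance (N : ℕ) : IsTopologicalGroup (SO N) where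
  continuous_inv := by
    refine Continuous.subtype_mk ?_ _
    exact Continuous.matrix_conjTranspose continuous_subtype_val

instance (N : ℕ) : CompactSpace (SO N) := by
  refine isCompact_iff_compactSpace.mp ?_
  have hbox : IsCompact (Set.pi Set.univ
      (fun _ : Fin N => Set.pi Set.univ (fun _ : Fin N => Set.Icc (-1 : ℝ) 1))) :=
    isCompact_univ_pi fun _ => isCompact_univ_pi fun _ => isCompact_Icc
  refine hbox.of_isClosed_subset ?_ ?_
  · have h : ((Matrix.specialOrthogonalGroup (Fin N) ℝ : Submonoid _) :
        Set (Matrix (Fin N) (Fin N) ℝ)) = {A | A * A.transpose = 1} ∩ {A | A.det = 1} := by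
      ext A
      simp only [SetLike.mem_coe, Matrix.mem_specialOrthogonalGroup_iff,
        Matrix.mem_orthogonalGroup_iff, Set.mem_inter_iff, Set.mem_ofPred_eq]
    rw [h]
    exact (isClosed_eq (by fun_prop) continuous_const).inter
      (isClosed_eq (by fun_prop) continuous_const)
  · intro A hA i _ j _
    have h := entry_norm_bound_of_unitary (𝕜 := ℝ)
      (Matrix.mem_specialOrthogonalGroup_iff.mp hA).1 i j
    exact abs_le.mp h

/-- The Haar probability measure on `SO(N)`. -/
noncomputable def haarSO (N : ℕ) : Measure (SO N) := Measure.haarMeasure ⊤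

/-- `E⁺_Λ`, the positively oriented edges with both ends in `Λ`. -/
abbrev PosEdgeIn (Λ : Finset (Fin d → ℤ)) : Type :=
  {e : Edge d // e.IsPos ∧ e.src ∈ Λ ∧ e.tgt ∈ Λ}

noncomputable instance (Λ : Finset (Fin d → ℤ)) : Fintype (PosEdgeIn Λ) :=
  ((finite_edges Λ).subset
    (show {e : Edge d | e.IsPos ∧ e.src ∈ Λ ∧ e.tgt ∈ Λ} ⊆ _ from fun _ h => h.2)).fintype

/-- Configurations `Q = (Q_e)` of the gauge field. -/
abbrev Config (Λ : Finset (Fin d → ℤ)) (N : ℕ) : Type := PosEdgeIn Λ → SO N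

open Classical in
/-- `Q_e` for any directed edge `e` in `Λ`, with `Q_e = (Q_{e⁻¹})⁻¹` if `e` is negatively oriented
(the value for edges outside `Λ` is a dummy). -/
noncomputable def edgeVar {Λ : Finset (Fin d → ℤ)} {N : ℕ} (Q : Config Λ N) (e : Edge d) : SO N :=
  if h : e.IsPos ∧ e.src ∈ Λ ∧ e.tgt ∈ Λ then Q ⟨e, h⟩
  else if h : e.inv.IsPos ∧ e.inv.src ∈ Λ ∧ e.inv.tgt ∈ Λ then (Q ⟨e.inv, h⟩)⁻¹
  else 1

/-- `Tr(Q_{e₁} ⋯ Q_{eₙ})` for a path `e₁⋯eₙ`; this is `N` for the null path. -/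
noncomputable def pathTrace {Λ : Finset (Fin d → ℤ)} {N : ℕ} (Q : Config Λ N)
    (ρ : List (Edge d)) : ℝ :=
  Matrix.trace ((ρ.map (edgeVar Q)).prod : SO N).1

theorem pathTrace_rotated {Λ : Finset (Fin d → ℤ)} {N : ℕ} (Q : Config Λ N)
    {ρ ρ' : List (Edge d)} (h : ρ.IsRotated ρ') : pathTrace Q ρ = pathTrace Q ρ' := by
  obtain ⟨n, rfl⟩ := h
  rw [List.rotate_eq_drop_append_take_mod]
  conv_lhs => rw [← List.take_append_drop (n % ρ.length) ρ]
  unfold pathTrace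
  rw [List.map_append, List.map_append, List.prod_append, List.prod_append]
  exact Matrix.trace_mul_comm _ _

/-- The Wilson loop variable `W_l`. -/
noncomputable def wilson {Λ : Finset (Fin d → ℤ)} {N : ℕ} (Q : Config Λ N) (l : Loop d) : ℝ :=
  Quotient.lift (pathTrace Q)
    (fun _ _ h => pathTrace_rotated Q (Cycle.coe_eq_coe.mp (Quotient.sound h))) l.1

/-- The lattice gauge measure `μ_{Λ,N,β}`: the product of Haar measures, with density
`Z⁻¹ exp(Nβ ∑_p Tr Q_p)`, the sum being over `𝒫⁺_Λ`. -/
noncomputable def gaugeMeasure (Λ : Finset (Fin d → ℤ)) (N : ℕ) (β : ℝ) : Measure (Config Λ N) :=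
  (Measure.pi fun _ : PosEdgeIn Λ => haarSO N).tilted
    fun Q => N * β * ∑ p ∈ plaquettesIn Λ, pathTrace Q p

/-- `φ_{Λ,N,β}(s) = ⟨W_{l₁} ⋯ W_{lₙ}⟩ / Nⁿ`, where `(l₁, …, lₙ)` is the minimal representation of
`s`. -/
noncomputable def wilsonPhi (Λ : Finset (Fin d → ℤ)) (N : ℕ) (β : ℝ) (s : LoopSeq d) : ℝ :=
  (∫ Q, (s.minRep.map (wilson Q)).prod ∂(gaugeMeasure Λ N β)) / (N : ℝ) ^ s.minRep.length

end LatticeGauge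

open LatticeGauge

namespace LatticeGauge

variable {d : ℕ}

/-! ### Walks and closed paths -/

/-! Uniqueness is a contraction argument. The limiting equation is linear in the function on loop
sequences, so the difference of two solutions is again a solution, now vanishing at the null
sequence. Give a loop of length n > 0 the weight K^n / (64 n²) with K = 256 L, the null loop the
weight 1, and a sequence the product of the weights of its loops. Since 1/n² convolved with itself
is of order 1/n², the splittings at one location carry in total at most a quarter of the weight of
the loop (`sum_splitWeight_le`). Deformations lengthen a loop by at most four edges, hence cost a
factor K⁴ and contribute at most another quarter once β is small (`abs_deformationTerm_le`). After
division by m, a bound M for the weighted norm of the difference improves to M/2 (`contraction`), so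
the difference is zero.

Existence needs no smallness of β. Multiply one edge variable by the rotations in a coordinate
plane. Haar invariance makes the integral of the resulting derivative vanish
(`HasLieDeriv.integral_eq_zero`). Apply this to the trace of a generator times the holonomy of l₁
cut open at a location of e, times the other normalized Wilson loops, times the Gibbs weight, and
sum over all planes. By `sum_trace_rotGen_mul_rotGen` and `sum_trace_rotGen_mul_trace`, derivatives
of l₁ produce splittings and derivatives of the action produce plaquette deformations. The remaining
terms, twistings of l₁ and mergers of l₁ with the other loops, are O(1/N) relative to these
(`abs_sum_ibpTerm_sub_le`). This gives one approximate equation for each location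
(`abs_integral_sdTerm_le`), and the sum of the equations over C is the master loop equation with an
O(1/N) error (`sum_locTerm`).

Normalized traces are bounded by 1, so along every ultrafilter finer than `atTop` the expectations
converge pointwise, and the limit solves the equation with L = 1 (`exists_ultrafilter_limit`). This
is existence. For small β uniqueness makes all these limits equal, and that is convergence of the
whole sequence. -/

/-- `Walk u ρ v`: the consecutive edges `ρ` lead from `u` to `v`. -/
def Walk : (Fin d → ℤ) → List (Edge d) → (Fin d → ℤ) → Prop
  | u, [], v => u = v
  | u, f :: t, v => f.src = u ∧ Walk f.tgt t v

@[simp] theorem walk_nil {u v : Fin d → ℤ} : Walk u [] v ↔ u = v := Iff.rfl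

@[simp] theorem walk_cons {u v : Fin d → ℤ} {f : Edge d} {t : List (Edge d)} :
    Walk u (f :: t) v ↔ f.src = u ∧ Walk f.tgt t v := Iff.rfl

theorem walk_append {a b : List (Edge d)} : ∀ {u v : Fin d → ℤ},
    Walk u (a ++ b) v ↔ ∃ w, Walk u a w ∧ Walk w b v := by
  induction a with
  | nil => simp
  | cons f t ih => intro u v; simp [ih, and_assoc]

theorem Walk.invPath {ρ : List (Edge d)} : ∀ {u v : Fin d → ℤ},
    Walk u ρ v → Walk v (invPath ρ) u := by
  induction ρ with
  | nil => intro u v h; exact h.symm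
  | cons f t ih =>
    rintro u v ⟨h1, h2⟩
    have := ih h2
    simp only [LatticeGauge.invPath, List.map_cons, List.reverse_cons] at this ⊢
    rw [walk_append]
    exact ⟨_, this, by simp [h1]⟩

theorem isChain_cons_append_singleton_iff {t : List (Edge d)} : ∀ {a b : Edge d},
    (a :: (t ++ [b])).IsChain (fun e f => e.tgt = f.src) ↔ Walk a.tgt t b.src := by
  induction t with
  | nil => simp
  | cons f t ih => intro a b; simp [List.isChain_cons_cons, ← ih, eq_comm]

/-- Walks with named endpoints can be cut and concatenated, which a cyclic chain condition cannot.
This is how the paths built by the loop operations are recognized as closed, so that their cores are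
not the dummy value. -/
theorem isClosedPath_iff {ρ : List (Edge d)} : IsClosedPath ρ ↔ ∃ u, Walk u ρ u := by
  unfold IsClosedPath
  cases ρ with
  | nil => exact iff_of_true (Cycle.Chain.nil _) ⟨0, rfl⟩
  | cons a t => rw [Cycle.chain_coe_cons, isChain_cons_append_singleton_iff]; simp

theorem Loop.isClosedPath {l : Loop d} {ρ : List (Edge d)} (h : (ρ : Cycle (Edge d)) = l.1) :
    IsClosedPath ρ := by
  unfold IsClosedPath; rw [h]; exact l.2.1

theorem Loop.length_eq {l : Loop d} {ρ : List (Edge d)} (h : (ρ : Cycle (Edge d)) = l.1) :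
    l.length = ρ.length := by
  unfold Loop.length; rw [← h]; rfl

theorem length_invPath (ρ : List (Edge d)) : (invPath ρ).length = ρ.length := by
  simp [invPath]

/-! ### Cores -/

theorem isCore_core {ρ : List (Edge d)} (h : IsClosedPath ρ) : IsCore ρ (core ρ) := by
  unfold core
  rw [dif_pos h]
  exact (exists_core ρ.length ρ rfl h).choose_spec

/-- Erasures only shorten a path, and the dummy value for a path that is not closed is the null
loop, so no hypothesis is needed and the length estimates never check closedness. -/
theorem length_core_le (ρ : List (Edge d)) : (core ρ).length ≤ ρ.length := by
  by_cases h : IsClosedPath ρ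
  · obtain ⟨ρ', h1, h2⟩ := isCore_core h
    rw [Loop.length_eq h2.symm]
    clear h2 h
    induction h1 with
    | refl => exact le_rfl
    | tail _ h ih => exact h.length_lt.le.trans ih
  · unfold core
    rw [dif_neg h]
    exact Nat.zero_le _

theorem Edge.src_ne_tgt (e : Edge d) : e.src ≠ e.tgt := by
  intro h
  have := e.adj
  simp [h] at this

theorem Edge.ne_inv (e : Edge d) : e ≠ e.inv := fun h => e.src_ne_tgt (congrArg Edge.src h)

theorem Edge.inv_ne (e : Edge d) : e.inv ≠ e := e.ne_inv.symm

theorem Edge.inv_injective : Function.Injective (Edge.inv : Edge d → Edge d) := fun e f h => by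
  simpa using congrArg Edge.inv h

theorem Edge.isPos_inv_iff (e : Edge d) : e.inv.IsPos ↔ ¬ e.IsPos := by
  unfold Edge.IsPos
  have h1 : toLex e.src ≠ toLex e.tgt := fun h => e.src_ne_tgt (toLex_inj.mp h)
  exact ⟨fun h2 h3 => lt_asymm (α := Lex (Fin d → ℤ)) h2 h3,
    fun h2 => (lt_trichotomy (α := Lex (Fin d → ℤ)) _ _).resolve_left h2 |>.resolve_left h1⟩

/-! ### Holonomies and Wilson loops -/

variable {Λ : Finset (Fin d → ℤ)} {N : ℕ}

theorem edgeVar_inv (Q : Config Λ N) (e : Edge d) : edgeVar Q e.inv = (edgeVar Q e)⁻¹ := by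
  have h := e.isPos_inv_iff
  unfold edgeVar
  by_cases hp : e.IsPos
  · have h' : ¬ e.inv.IsPos := by tauto
    by_cases h1 : e.src ∈ Λ ∧ e.tgt ∈ Λ
    · simp [hp, h', h1]
    · simp [hp, h', h1]
  · have h' : e.inv.IsPos := by tauto
    by_cases h1 : e.tgt ∈ Λ ∧ e.src ∈ Λ
    · simp [hp, h', h1]
    · simp [hp, h', h1]

/-- The holonomy `Q_{e₁} ⋯ Q_{eₙ}` of a path. -/
noncomputable def hol (Q : Config Λ N) (ρ : List (Edge d)) : SO N := (ρ.map (edgeVar Q)).prod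

@[simp] theorem hol_nil (Q : Config Λ N) : hol Q [] = 1 := rfl

@[simp] theorem hol_cons (Q : Config Λ N) (e : Edge d) (ρ : List (Edge d)) :
    hol Q (e :: ρ) = edgeVar Q e * hol Q ρ := by simp [hol]

@[simp] theorem hol_append (Q : Config Λ N) (ρ ρ' : List (Edge d)) :
    hol Q (ρ ++ ρ') = hol Q ρ * hol Q ρ' := by simp [hol]

@[simp] theorem hol_invPath (Q : Config Λ N) (ρ : List (Edge d)) :
    hol Q (invPath ρ) = (hol Q ρ)⁻¹ := by
  induction ρ with
  | nil => simp [invPath]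
  | cons f t ih =>
    rw [invPath] at ih
    simp [invPath, ih, edgeVar_inv]

theorem pathTrace_eq (Q : Config Λ N) (ρ : List (Edge d)) :
    pathTrace Q ρ = Matrix.trace (hol Q ρ).1 := rfl

theorem pathTrace_append_comm (Q : Config Λ N) (ρ ρ' : List (Edge d)) :
    pathTrace Q (ρ ++ ρ') = pathTrace Q (ρ' ++ ρ) := by
  simp only [pathTrace_eq, hol_append]
  exact Matrix.trace_mul_comm _ _

/-- An interior backtrack contributes a factor Q Q⁻¹; cyclicity of the trace makes a terminal one
interior. -/
theorem Erase.pathTrace_eq {ρ ρ' : List (Edge d)} (h : Erase ρ ρ') (Q : Config Λ N) :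
    pathTrace Q ρ = pathTrace Q ρ' := by
  cases h with
  | interior a b e =>
    simp [LatticeGauge.pathTrace_eq, edgeVar_inv]
  | terminal b e =>
    rw [← List.cons_append, pathTrace_append_comm]
    simp [LatticeGauge.pathTrace_eq, edgeVar_inv]

theorem wilson_eq {l : Loop d} {ρ : List (Edge d)} (h : (ρ : Cycle (Edge d)) = l.1)
    (Q : Config Λ N) : wilson Q l = pathTrace Q ρ := by
  unfold wilson
  rw [← h]
  rfl

/-- The trace is constant along erasures, so whichever core was chosen has the right value, and
uniqueness of the core is never needed. -/
theorem wilson_core {ρ : List (Edge d)} (h : IsClosedPath ρ) (Q : Config Λ N) :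
    wilson Q (core ρ) = pathTrace Q ρ := by
  obtain ⟨ρ', h1, h2⟩ := isCore_core h
  rw [wilson_eq h2.symm]
  clear h2 h
  induction h1 with
  | refl => rfl
  | tail _ h ih => rw [← h.pathTrace_eq, ih]

theorem wilson_null (Q : Config Λ N) : wilson Q Loop.null = N := by
  rw [wilson_eq (ρ := []) rfl]
  simp [pathTrace_eq]

theorem exists_list (l : Loop d) : ∃ ρ : List (Edge d), (ρ : Cycle (Edge d)) = l.1 :=
  ⟨Quotient.out l.1, Quotient.out_eq _⟩

/-! ### Locations -/

theorem mem_locs {ρ : List (Edge d)} {e : Edge d} {x : ℕ} : x ∈ locs ρ e ↔ ρ[x]? = some e := by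
  simp only [locs, Finset.mem_filter, Finset.mem_range, and_iff_right_iff_imp]
  intro h
  exact (List.getElem?_eq_some_iff.mp h).1

theorem eq_before_append {ρ : List (Edge d)} {e : Edge d} {x : ℕ} (h : ρ[x]? = some e) :
    ρ = before ρ x ++ e :: after ρ x := by
  obtain ⟨h1, h2⟩ := List.getElem?_eq_some_iff.mp h
  unfold before after
  rw [← h2, List.cons_getElem_drop_succ, List.take_append_drop]

theorem length_before {ρ : List (Edge d)} {x : ℕ} (h : x < ρ.length) :
    (before ρ x).length = x := by
  simp [before, h.le]

theorem length_after (ρ : List (Edge d)) (x : ℕ) :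
    (after ρ x).length = ρ.length - (x + 1) := by
  simp [after]

theorem length_between {ρ : List (Edge d)} {x y : ℕ} (hy : y < ρ.length) :
    (between ρ x y).length = y - (x + 1) := by
  simp [between, hy.le]

theorem disjoint_locs_inv (ρ : List (Edge d)) (e : Edge d) :
    Disjoint (locs ρ e) (locs ρ e.inv) := by
  rw [Finset.disjoint_left]
  intro x h1 h2
  rw [mem_locs] at h1 h2
  rw [h1] at h2
  exact e.ne_inv (Option.some.inj h2)

theorem sum_locs_append {M : Type*} [AddCommMonoid M] (a b : List (Edge d)) (f : Edge d)
    (G : ℕ → M) :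
    ∑ y ∈ locs (a ++ b) f, G y = ∑ y ∈ locs a f, G y + ∑ y ∈ locs b f, G (a.length + y) := by
  simp only [locs, Finset.sum_filter, List.length_append]
  rw [Finset.sum_range_add]
  congr 1
  · refine Finset.sum_congr rfl fun y hy => ?_
    rw [List.getElem?_append_left (Finset.mem_range.mp hy)]
  · refine Finset.sum_congr rfl fun y _ => ?_
    rw [List.getElem?_append_right (Nat.le_add_right _ _), Nat.add_sub_cancel_left]

theorem sum_locs_cons {M : Type*} [AddCommMonoid M] (e : Edge d) (c : List (Edge d)) (f : Edge d)
    (G : ℕ → M) :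
    ∑ y ∈ locs (e :: c) f, G y =
      (if e = f then G 0 else 0) + ∑ y ∈ locs c f, G (1 + y) := by
  rw [← List.singleton_append, sum_locs_append]
  congr 1
  by_cases h : e = f
  · rw [if_pos h, show locs [e] f = {0} from ?_, Finset.sum_singleton]
    ext y
    rw [mem_locs, List.getElem?_singleton]
    by_cases hy : y = 0 <;> simp [hy, h]
  · rw [if_neg h, show locs [e] f = ∅ from ?_, Finset.sum_empty]
    ext y
    rw [mem_locs, List.getElem?_singleton]
    by_cases hy : y = 0 <;> simp [hy, h]

/-- Sum over the locations of `f` different from a given location `x`. -/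
theorem sum_locs_erase {ρ : List (Edge d)} {e : Edge d} {x : ℕ} (hx : ρ[x]? = some e) (f : Edge d)
    (G : ℕ → ℝ) :
    ∑ y ∈ (locs ρ f).erase x, G y =
      ∑ y ∈ locs (before ρ x) f, G y + ∑ y ∈ locs (after ρ x) f, G (x + 1 + y) := by
  have hl : (before ρ x).length = x :=
    length_before (List.getElem?_eq_some_iff.mp hx).1
  have h1 := sum_locs_append (before ρ x) (e :: after ρ x) f G
  rw [← eq_before_append hx, sum_locs_cons, hl] at h1
  by_cases h : e = f
  · have hm : x ∈ locs ρ f := mem_locs.mpr (h ▸ hx)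
    rw [← Finset.add_sum_erase _ _ hm, if_pos h] at h1
    simp only [add_zero, ← add_assoc] at h1 ⊢
    linarith
  · have hm : x ∉ locs ρ f := fun hm => h (by
      rw [mem_locs, hx] at hm; exact Option.some.inj hm)
    rw [Finset.erase_eq_of_notMem hm, h1, if_neg h]
    simp only [zero_add, ← add_assoc]

/-! ### Loop sequences -/

theorem LoopSeq.minRep_mk (s : List (Loop d)) : (LoopSeq.mk s).minRep = dropNull s := rfl

theorem LoopSeq.mk_minRep (s : LoopSeq d) : LoopSeq.mk s.minRep = s := by
  induction s using Quotient.inductionOn with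
  | h s =>
    refine Quotient.sound ?_
    change dropNull (dropNull s) = dropNull s
    simp [dropNull]

theorem LoopSeq.ne_null_of_mem_minRep {s : LoopSeq d} {l : Loop d} (h : l ∈ s.minRep) :
    l ≠ Loop.null := by
  induction s using Quotient.inductionOn with
  | h s =>
    have h' : l ∈ dropNull s := h
    simpa using (List.mem_filter.mp h').2

theorem LoopSeq.minRep_null : (LoopSeq.null : LoopSeq d).minRep = [] := by
  simp [LoopSeq.null, LoopSeq.minRep_mk, dropNull]

/-- Products over loops in which null loops contribute `1` do not see null loops. -/
theorem prod_map_dropNull {g : Loop d → ℝ} (hg : g Loop.null = 1) (s : List (Loop d)) :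
    ((dropNull s).map g).prod = (s.map g).prod := by
  induction s with
  | nil => rfl
  | cons l t ih =>
    by_cases h : l = Loop.null
    · subst h
      simpa [dropNull, hg] using ih
    · have h' : dropNull (l :: t) = l :: dropNull t := by simp [dropNull, h]
      rw [h', List.map_cons, List.map_cons, List.prod_cons, List.prod_cons, ih]

theorem Loop.length_pos {l : Loop d} (h : l ≠ Loop.null) : 0 < l.length := by
  obtain ⟨ρ, hρ⟩ := exists_list l
  rw [Loop.length_eq hρ, List.length_pos_iff]
  rintro rfl
  exact h (Subtype.ext hρ.symm)

/-! ### Plaquettes -/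

theorem mem_plaquettesAt {e : Edge d} {p : List (Edge d)} :
    p ∈ plaquettesAt e ↔ IsPosPlaquette p ∧ (e ∈ p ∨ e.inv ∈ p) := by
  simp [plaquettesAt]

theorem mem_plaquettesIn {p : List (Edge d)} :
    p ∈ plaquettesIn Λ ↔ IsPosPlaquette p ∧ ∀ f ∈ p, f.src ∈ Λ ∧ f.tgt ∈ Λ := by
  simp [plaquettesIn]

theorem plaquettesAt_inv (e : Edge d) : plaquettesAt e.inv = plaquettesAt e := by
  ext p
  rw [mem_plaquettesAt, mem_plaquettesAt, Edge.inv_inv, or_comm (a := e ∈ p)]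

theorem IsPosPlaquette.length {p : List (Edge d)} (h : IsPosPlaquette p) : p.length = 4 := by
  obtain ⟨-, -, e₁, e₂, e₃, e₄, rfl, -⟩ := h
  rfl

theorem getElem?_locIn {p : List (Edge d)} {e : Edge d} (h : e ∈ p ∨ e.inv ∈ p) :
    p[locIn p e]? = some e ∨ p[locIn p e]? = some e.inv := by
  have h1 : locIn p e < p.length := by
    unfold locIn
    rw [List.findIdx_lt_length]
    rcases h with h | h
    · exact ⟨_, h, by simp⟩
    · exact ⟨_, h, by simp⟩
  have h2 := List.findIdx_getElem (p := fun f => decide (f = e ∨ f = e.inv)) (xs := p) (w := h1)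
  rw [decide_eq_true_iff] at h2
  rw [List.getElem?_eq_getElem h1]
  rcases h2 with h2 | h2
  · exact Or.inl (congrArg some h2)
  · exact Or.inr (congrArg some h2)

/-- An edge or its inverse occurs at one location of a plaquette at most. -/
theorem IsPosPlaquette.eq_of_getElem? {p : List (Edge d)} (hp : IsPosPlaquette p) {e f g : Edge d}
    {x y : ℕ} (hx : p[x]? = some f) (hy : p[y]? = some g) (hf : f = e ∨ f = e.inv)
    (hg : g = e ∨ g = e.inv) : x = y := by
  have key : ∀ {x y : ℕ} {f g : Edge d}, p[x]? = some f → p[y]? = some g → x < y →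
      g ≠ f ∧ g ≠ f.inv := by
    obtain ⟨hc, hn, e₁, e₂, e₃, e₄, rfl, -⟩ := hp
    unfold IsClosedPath at hc
    unfold IsNonbacktracking at hn
    rw [Cycle.chain_coe_cons] at hc hn
    simp only [List.cons_append, List.nil_append, List.isChain_cons_cons,
      List.isChain_singleton, and_true] at hc hn
    obtain ⟨c1, c2, c3, c4⟩ := hc
    obtain ⟨n1, n2, n3, n4⟩ := hn
    -- Three local facts cover all pairs of edges in a 4-cycle. Consecutive edges differ because no
    -- edge is a self-loop. If the edge two steps after a were a, the one between would be a⁻¹, a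
    -- backtrack; if it were a⁻¹, the one between would be a self-loop.
    have adj : ∀ {a b : Edge d}, a.tgt = b.src → b ≠ a := fun {a b} h h' =>
      a.src_ne_tgt (by rw [h, h'])
    have opp1 : ∀ {a b c : Edge d}, a.tgt = b.src → b.tgt = c.src → b ≠ a.inv → c ≠ a := by
      intro a b c h1 h2 h3 h4
      exact h3 (Edge.ext (by simp [h1]) (by simp [h2, h4]))
    have opp2 : ∀ {a b c : Edge d}, a.tgt = b.src → b.tgt = c.src → c ≠ a.inv := by
      intro a b c h1 h2 h4
      exact b.src_ne_tgt (by rw [h2, h4, ← h1, Edge.inv_src])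
    intro x y f g hx hy hxy
    have hy4 : y < 4 := (List.getElem?_eq_some_iff.mp hy).1
    have hx4 : x < 4 := by omega
    interval_cases y <;> interval_cases x <;> simp only [List.getElem?_cons_zero,
      List.getElem?_cons_succ, Option.some.injEq] at hx hy <;> subst hx <;> subst hy
    · exact ⟨adj c1, n1⟩
    · exact ⟨opp1 c1 c2 n1, opp2 c1 c2⟩
    · exact ⟨adj c2, n2⟩
    -- The first and last edges are also consecutive, through the closing of the cycle.
    · exact ⟨(adj c4).symm, fun h => n4 (by rw [h, Edge.inv_inv])⟩
    · exact ⟨opp1 c2 c3 n2, opp2 c2 c3⟩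
    · exact ⟨adj c3, n3⟩
  by_contra hxy
  have key' : ∀ {x y : ℕ} {f g : Edge d}, p[x]? = some f → p[y]? = some g → x < y →
      (f = e ∨ f = e.inv) → (g = e ∨ g = e.inv) → False := by
    intro x y f g hx hy hxy hf hg
    obtain ⟨h1, h2⟩ := key hx hy hxy
    rcases hf with rfl | rfl <;> rcases hg with rfl | rfl <;> simp_all
  rcases Nat.lt_or_gt_of_ne hxy with h | h
  · exact key' hx hy h hf hg
  · exact key' hy hx h hg hf

theorem locs_locIn {p : List (Edge d)} (hp : IsPosPlaquette p) {e f : Edge d}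
    (hf : f = e ∨ f = e.inv) (h : p[locIn p e]? = some f) :
    locs p f = {locIn p e} ∧ locs p f.inv = ∅ := by
  have hf' : f.inv = e ∨ f.inv = e.inv := by
    rcases hf with rfl | rfl <;> simp
  constructor
  · ext y
    rw [mem_locs, Finset.mem_singleton]
    exact ⟨fun hy => hp.eq_of_getElem? hy h hf hf, fun hy => hy ▸ h⟩
  · ext y
    rw [mem_locs]
    simp only [Finset.notMem_empty, iff_false]
    intro hy
    have := hp.eq_of_getElem? hy h hf' hf
    rw [this, h] at hy
    exact f.ne_inv (Option.some.inj hy)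

theorem locs_eq_empty {p : List (Edge d)} {e : Edge d} (h : e ∉ p) : locs p e = ∅ := by
  ext y
  rw [mem_locs]
  simp only [Finset.notMem_empty, iff_false]
  exact fun hy => h (List.mem_of_getElem? hy)

/-! ### The number of plaquettes at an edge -/

/-- Translation of an edge. -/
def Edge.shift (v : Fin d → ℤ) (e : Edge d) : Edge d where
  src := e.src + v
  tgt := e.tgt + v
  adj := by simpa using e.adj

theorem Edge.shift_injective (v : Fin d → ℤ) : Function.Injective (Edge.shift v) := by
  intro e f h
  have h1 : e.src + v = f.src + v := congrArg Edge.src h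
  have h2 : e.tgt + v = f.tgt + v := congrArg Edge.tgt h
  exact Edge.ext (add_right_cancel h1) (add_right_cancel h2)

theorem plaquettesAt_near {e : Edge d} {p : List (Edge d)} (h : p ∈ plaquettesAt e) :
    ∀ f ∈ p, ∀ i, (-5 ≤ f.src i - e.src i ∧ f.src i - e.src i ≤ 5) ∧
      (-5 ≤ f.tgt i - e.src i ∧ f.tgt i - e.src i ≤ 5) := by
  obtain ⟨⟨hc, -, e₁, e₂, e₃, e₄, rfl, -⟩, he⟩ := mem_plaquettesAt.mp h
  obtain ⟨u, c0, c1, c2, c3, c4⟩ := isClosedPath_iff.mp hc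
  intro f hf i
  have b0 := abs_le.mp (e.abs_sub_le i)
  have b1 := abs_le.mp (e₁.abs_sub_le i)
  have b2 := abs_le.mp (e₂.abs_sub_le i)
  have b3 := abs_le.mp (e₃.abs_sub_le i)
  have b4 := abs_le.mp (e₄.abs_sub_le i)
  have d0 := congrFun c0 i
  have d1 := congrFun c1 i
  have d2 := congrFun c2 i
  have d3 := congrFun c3 i
  have d4 := congrFun c4 i
  have key : ∃ z : ℤ, (z = e.src i ∨ z = e.tgt i) ∧
      (z = e₁.src i ∨ z = e₂.src i ∨ z = e₃.src i ∨ z = e₄.src i) := by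
    rcases he with he | he
    · simp only [List.mem_cons, List.not_mem_nil, or_false] at he
      exact ⟨e.src i, Or.inl rfl, by rcases he with h | h | h | h <;> simp [h]⟩
    · simp only [List.mem_cons, List.not_mem_nil, or_false] at he
      exact ⟨e.tgt i, Or.inr rfl, by rcases he with h | h | h | h <;> simp [← h]⟩
  obtain ⟨z, h1, h2⟩ := key
  simp only [List.mem_cons, List.not_mem_nil, or_false] at hf
  rcases hf with rfl | rfl | rfl | rfl <;> refine ⟨⟨?_, ?_⟩, ?_, ?_⟩ <;> omega

/-- Translating the start of e to the origin maps the plaquettes at e injectively into the paths of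
length 4 in one fixed box, so the bound is uniform in e. Finiteness at each edge would not give a β₀
valid for all loops. -/
theorem exists_card_plaquettesAt_le (d : ℕ) :
    ∃ P : ℕ, ∀ e : Edge d, (plaquettesAt e).card ≤ P := by
  refine ⟨(finite_paths (Finset.Icc (fun _ : Fin d => (-5 : ℤ)) (fun _ => 5)) 4).toFinset.card,
    fun e => Finset.card_le_card_of_injOn (List.map (Edge.shift (-e.src))) ?_
      (List.map_injective_iff.mpr (Edge.shift_injective _)).injOn⟩
  intro p hp
  have hp' : p ∈ plaquettesAt e := hp
  have := plaquettesAt_near hp'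
  simp only [Set.Finite.coe_toFinset, Set.mem_ofPred_eq, List.length_map,
    (mem_plaquettesAt.mp hp').1.length, true_and]
  intro f hf
  obtain ⟨g, hg, rfl⟩ := List.mem_map.mp hf
  simp only [Finset.mem_Icc, Pi.le_def, Edge.shift, ← sub_eq_add_neg]
  exact ⟨⟨fun i => (this g hg i).1.1, fun i => (this g hg i).1.2⟩,
    ⟨fun i => (this g hg i).2.1, fun i => (this g hg i).2.2⟩⟩

/-! ### Weights -/

/-- The weight of a loop of length `n`. -/
noncomputable def loopWeight (K : ℝ) (n : ℕ) : ℝ := if n = 0 then 1 else K ^ n / (64 * n ^ 2)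

theorem loopWeight_zero (K : ℝ) : loopWeight K 0 = 1 := by simp [loopWeight]

theorem loopWeight_succ (K : ℝ) (n : ℕ) :
    loopWeight K (n + 1) = K ^ (n + 1) / (64 * ((n : ℝ) + 1) ^ 2) := by
  simp [loopWeight]

theorem loopWeight_pos {K : ℝ} (hK : 0 < K) (n : ℕ) : 0 < loopWeight K n := by
  unfold loopWeight
  split_ifs with h
  · exact one_pos
  · have : 0 < n := Nat.pos_of_ne_zero h
    positivity

/-- The step from length 0 to length 1 reads 1 ≤ K/64 and forces the hypothesis; later steps only
need K to beat the ratio of consecutive squares. -/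
theorem loopWeight_mono {K : ℝ} (hK : 64 ≤ K) : Monotone (loopWeight K) := by
  refine monotone_nat_of_le_succ fun n => ?_
  rw [loopWeight_succ]
  rcases n with _ | n
  · rw [loopWeight_zero, le_div_iff₀ (by norm_num)]
    simpa using hK
  · rw [loopWeight_succ, div_le_div_iff₀ (by positivity) (by positivity), pow_succ K (n + 1)]
    push_cast
    have h1 : 0 ≤ K ^ (n + 1) := by positivity
    have h2 : ((n : ℝ) + 1 + 1) ^ 2 ≤ K * ((n : ℝ) + 1) ^ 2 := by
      have : (0 : ℝ) ≤ n := n.cast_nonneg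
      nlinarith [mul_nonneg (sub_nonneg.mpr hK) (sq_nonneg ((n : ℝ) + 1))]
    nlinarith [mul_le_mul_of_nonneg_left h2 h1]

theorem loopWeight_add_four_le {K : ℝ} (hK : 0 < K) {n : ℕ} (hn : 0 < n) :
    loopWeight K (n + 4) ≤ K ^ 4 * loopWeight K n := by
  obtain ⟨n, rfl⟩ := Nat.exists_eq_succ_of_ne_zero hn.ne'
  rw [Nat.succ_eq_add_one, show n + 1 + 4 = (n + 4) + 1 by ring, loopWeight_succ, loopWeight_succ,
    ← mul_div_assoc, ← pow_add, show 4 + (n + 1) = n + 4 + 1 by ring]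
  gcongr
  linarith

/-- The constant is 256 = 64 · 2²: it absorbs the denominator through 64 ≤ 64^n and n ≤ 2^n.
Exponentially bounded functions thus have finite weighted norm. -/
theorem pow_le_loopWeight {L : ℝ} (hL : 0 ≤ L) (n : ℕ) : L ^ n ≤ loopWeight (256 * L) n := by
  rcases n with _ | n
  · simp [loopWeight_zero]
  · rw [loopWeight_succ, mul_pow, le_div_iff₀ (by positivity), mul_comm]
    refine mul_le_mul_of_nonneg_right ?_ (by positivity)
    have h1 : (64 : ℝ) ≤ 64 ^ (n + 1) := le_self_pow₀ (by norm_num) (by omega)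
    have h2 : ((n : ℝ) + 1) ≤ 2 ^ (n + 1) := by
      exact_mod_cast (Nat.lt_two_pow_self (n := n + 1)).le
    calc 64 * ((n : ℝ) + 1) ^ 2 ≤ 64 ^ (n + 1) * (2 ^ (n + 1)) ^ 2 := by gcongr
      _ = 256 ^ (n + 1) := by rw [← pow_mul, mul_comm (n + 1) 2, pow_mul, ← mul_pow]; norm_num

/-- Telescoping, by 1/(m+1)² ≤ 1/m − 1/(m+1). For m = 0 the last term is 1/0 = 0. -/
theorem sum_inv_sq_le (m : ℕ) :
    ∑ j ∈ Finset.range m, 1 / ((j : ℝ) + 1) ^ 2 ≤ 2 - 1 / (m : ℝ) := by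
  induction m with
  | zero => simp
  | succ m ih =>
    rw [Finset.sum_range_succ]
    rcases m with _ | m
    · norm_num
    · have : 1 / (((m + 1 : ℕ) : ℝ) + 1) ^ 2 ≤ 1 / ((m + 1 : ℕ) : ℝ) - 1 / ((m + 1 + 1 : ℕ) : ℝ) := by
        push_cast
        rw [div_sub_div _ _ (by positivity) (by positivity),
          div_le_div_iff₀ (by positivity) (by positivity)]
        have : (0 : ℝ) ≤ m := m.cast_nonneg
        nlinarith
      linarith

theorem sum_inv_sq_le_two (m : ℕ) : ∑ j ∈ Finset.range m, 1 / ((j : ℝ) + 1) ^ 2 ≤ 2 :=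
  (sum_inv_sq_le m).trans (sub_le_self _ (by positivity))

/-- The weights are submultiplicative on average under convolution. -/
theorem sum_loopWeight_mul_le {K : ℝ} (hK : 0 < K) (n : ℕ) :
    ∑ j ∈ Finset.range n, loopWeight K (n + 1 - (j + 1)) * loopWeight K (j + 1) ≤
      loopWeight K (n + 1) / 8 := by
  have h1 : ∀ j ∈ Finset.range n, loopWeight K (n + 1 - (j + 1)) * loopWeight K (j + 1) ≤
      K ^ (n + 1) / (64 * 64) * (2 / ((n : ℝ) + 1) ^ 2) *
        (1 / ((j : ℝ) + 1) ^ 2 + 1 / (((n - 1 - j : ℕ) : ℝ) + 1) ^ 2) := by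
    intro j hj
    obtain ⟨r, rfl⟩ := Nat.exists_eq_add_of_lt (Finset.mem_range.mp hj)
    have e1 : j + r + 1 + 1 - (j + 1) = r + 1 := by omega
    have e2 : j + r + 1 - 1 - j = r := by omega
    rw [e1, e2, loopWeight_succ, loopWeight_succ]
    have e3 : K ^ (j + r + 1 + 1) = K ^ (r + 1) * K ^ (j + 1) := by
      rw [← pow_add]; congr 1; ring
    rw [e3, div_mul_div_comm]
    have h0 : 0 ≤ K ^ (r + 1) * K ^ (j + 1) / (64 * 64) := by positivity
    -- With a = r + 1 and b = j + 1 this is (a + b)² ≤ 2(a² + b²) divided by a²b²(a + b)².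
    have : 1 / (((r : ℝ) + 1) ^ 2 * ((j : ℝ) + 1) ^ 2) ≤ (2 / (((j + r + 1 : ℕ) : ℝ) + 1) ^ 2) *
        (1 / ((j : ℝ) + 1) ^ 2 + 1 / ((r : ℝ) + 1) ^ 2) := by
      push_cast
      rw [div_add_div _ _ (by positivity) (by positivity), div_mul_div_comm,
        div_le_div_iff₀ (by positivity) (by positivity)]
      have : 0 ≤ ((r : ℝ) + 1) ^ 2 * ((j : ℝ) + 1) ^ 2 := by positivity
      nlinarith [mul_nonneg this (sq_nonneg ((r : ℝ) - j))]
    calc _ = K ^ (r + 1) * K ^ (j + 1) / (64 * 64) *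
          (1 / (((r : ℝ) + 1) ^ 2 * ((j : ℝ) + 1) ^ 2)) := by
          field_simp
      _ ≤ _ := by
          rw [mul_assoc]
          exact mul_le_mul_of_nonneg_left this h0
  refine (Finset.sum_le_sum h1).trans ?_
  rw [← Finset.mul_sum, Finset.sum_add_distrib,
    Finset.sum_range_reflect (fun j => 1 / ((j : ℝ) + 1) ^ 2) n, loopWeight_succ]
  have h2 := sum_inv_sq_le_two n
  -- Both sums of inverse squares are at most 2, which leaves the factor 2 · 4 / 64² = 1 / (8 · 64).
  calc _ ≤ K ^ (n + 1) / (64 * 64) * (2 / ((n : ℝ) + 1) ^ 2) * (2 + 2) := by gcongr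
    _ = _ := by field_simp; norm_num

/-- A bound for the product of the weights of the two loops that come from a splitting at the
locations `x, y` of a loop of length `n`. -/
noncomputable def splitWeight (K : ℝ) (n x y : ℕ) : ℝ :=
  if x < y then loopWeight K (n - (y - x)) * loopWeight K (y - x)
  else loopWeight K (n - (x - y)) * loopWeight K (x - y)

theorem splitWeight_nonneg {K : ℝ} (hK : 0 < K) (n x y : ℕ) : 0 ≤ splitWeight K n x y := by
  unfold splitWeight
  have := fun m => (loopWeight_pos hK m).le
  split_ifs <;> exact mul_nonneg (this _) (this _)

/-- The weight depends only on the distance of y from x. Each distance occurs at most once on either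
side of x, so the convolution bound is used twice. -/
theorem sum_splitWeight_le {K : ℝ} (hK : 0 < K) {n x : ℕ} (hx : x < n) :
    ∑ y ∈ (Finset.range n).erase x, splitWeight K n x y ≤ loopWeight K n / 4 := by
  obtain ⟨r, rfl⟩ := Nat.exists_eq_add_of_lt hx
  have hpos := fun m => (loopWeight_pos hK m).le
  have key : ∀ m, m ≤ x + r → ∑ j ∈ Finset.range m,
      loopWeight K (x + r + 1 - (j + 1)) * loopWeight K (j + 1) ≤ loopWeight K (x + r + 1) / 8 :=
    fun m hm => (Finset.sum_le_sum_of_subset_of_nonneg (Finset.range_mono hm)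
      (fun _ _ _ => mul_nonneg (hpos _) (hpos _))).trans (sum_loopWeight_mul_le hK (x + r))
  have h1 := Finset.add_sum_erase (Finset.range (x + r + 1)) (splitWeight K (x + r + 1) x)
    (Finset.mem_range.mpr hx)
  have h2 : ∑ y ∈ Finset.range (x + r + 1), splitWeight K (x + r + 1) x y =
      ∑ y ∈ Finset.range x, splitWeight K (x + r + 1) x y + splitWeight K (x + r + 1) x x +
      ∑ i ∈ Finset.range r, splitWeight K (x + r + 1) x (x + 1 + i) := by
    rw [show x + r + 1 = (x + 1) + r by ring, Finset.sum_range_add, Finset.sum_range_succ]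
  have h3 : ∑ i ∈ Finset.range r, splitWeight K (x + r + 1) x (x + 1 + i) ≤
      loopWeight K (x + r + 1) / 8 := by
    refine le_trans (le_of_eq (Finset.sum_congr rfl fun i _ => ?_)) (key r (by omega))
    unfold splitWeight
    rw [if_pos (by omega), show x + 1 + i - x = i + 1 by omega]
  have h4 : ∑ y ∈ Finset.range x, splitWeight K (x + r + 1) x y ≤
      loopWeight K (x + r + 1) / 8 := by
    rw [← Finset.sum_range_reflect]
    refine le_trans (le_of_eq (Finset.sum_congr rfl fun i hi => ?_)) (key x (by omega))
    have := Finset.mem_range.mp hi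
    unfold splitWeight
    rw [if_neg (by omega), show x - (x - 1 - i) = i + 1 by omega]
  linarith

/-- The two pieces have fewer edges than the lengths used in `splitWeight`, since e and e⁻¹ are
removed. Monotonicity of the weight allows rounding up, so that positive and negative splittings
share one bound. -/
theorem loopWeight_negSplit_le {K : ℝ} (hK : 64 ≤ K) {ρ : List (Edge d)} {x y : ℕ}
    (hx : x < ρ.length) (hy : y < ρ.length) :
    loopWeight K (negSplit ρ x y).1.length * loopWeight K (negSplit ρ x y).2.length ≤
      splitWeight K ρ.length x y := by
  have hpos := fun m => (loopWeight_pos (by linarith : 0 < K) m).le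
  have hm := loopWeight_mono hK
  unfold negSplit splitWeight
  split_ifs with h
  · refine mul_le_mul (hm ((length_core_le _).trans ?_)) (hm ((length_core_le _).trans ?_))
      (hpos _) (hpos _)
    · rw [List.length_append, length_before hx, length_after]; omega
    · rw [length_between hy]; omega
  · rw [mul_comm]
    refine mul_le_mul (hm ((length_core_le _).trans ?_)) (hm ((length_core_le _).trans ?_))
      (hpos _) (hpos _)
    · rw [List.length_append, length_before hy, length_after]; omega
    · rw [length_between hx]; omega

theorem loopWeight_posSplit_le {K : ℝ} (hK : 64 ≤ K) {ρ : List (Edge d)} (e : Edge d) {x y : ℕ}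
    (hx : x < ρ.length) (hy : y < ρ.length) (hxy : x ≠ y) :
    loopWeight K (posSplit ρ e x y).1.length * loopWeight K (posSplit ρ e x y).2.length ≤
      splitWeight K ρ.length x y := by
  have hpos := fun m => (loopWeight_pos (by linarith : 0 < K) m).le
  have hm := loopWeight_mono hK
  unfold posSplit splitWeight
  split_ifs with h
  · refine mul_le_mul (hm ((length_core_le _).trans ?_)) (hm ((length_core_le _).trans ?_))
      (hpos _) (hpos _)
    · rw [List.length_append, List.length_cons, length_before hx, length_after]; omega
    · rw [List.length_append, List.length_singleton, length_between hy]; omega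
  · rw [mul_comm]
    refine mul_le_mul (hm ((length_core_le _).trans ?_)) (hm ((length_core_le _).trans ?_))
      (hpos _) (hpos _)
    · rw [List.length_append, List.length_cons, length_before hy, length_after]; omega
    · rw [List.length_append, List.length_singleton, length_between hx]; omega

theorem locIn_lt_length {p : List (Edge d)} {e : Edge d} (h : e ∈ p ∨ e.inv ∈ p) :
    locIn p e < p.length := by
  rcases getElem?_locIn h with h | h <;> exact (List.getElem?_eq_some_iff.mp h).1

theorem length_posDeform_le {ρ p : List (Edge d)} {e : Edge d} {x : ℕ} (hx : x < ρ.length)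
    (hp : p ∈ plaquettesAt e) : (posDeform ρ e x p).length ≤ ρ.length + 4 := by
  obtain ⟨h1, h2⟩ := mem_plaquettesAt.mp hp
  have h3 := locIn_lt_length h2
  have h4 := h1.length
  unfold posDeform posMerge
  split_ifs <;> refine (length_core_le _).trans ?_ <;>
  · simp only [List.length_append, List.length_singleton, length_invPath, length_before hx,
      length_before h3, length_after, h4]
    omega

theorem length_negDeform_le {ρ p : List (Edge d)} {e : Edge d} {x : ℕ} (hx : x < ρ.length)
    (hp : p ∈ plaquettesAt e) : (negDeform ρ e x p).length ≤ ρ.length + 4 := by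
  obtain ⟨h1, h2⟩ := mem_plaquettesAt.mp hp
  have h3 := locIn_lt_length h2
  have h4 := h1.length
  unfold negDeform negMerge
  split_ifs <;> refine (length_core_le _).trans ?_ <;>
  · simp only [List.length_append, length_invPath, length_before hx,
      length_before h3, length_after, h4]
    omega

/-- The weight of a sequence of loops. -/
noncomputable def seqWeight (K : ℝ) (ls : List (Loop d)) : ℝ :=
  (ls.map fun l => loopWeight K l.length).prod

theorem seqWeight_cons (K : ℝ) (l : Loop d) (ls : List (Loop d)) :
    seqWeight K (l :: ls) = loopWeight K l.length * seqWeight K ls := by simp [seqWeight]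

/-- Splittings and deformations can create null loops. Because these have weight 1, the weight can
be computed from any representative. -/
theorem seqWeight_minRep_mk (K : ℝ) (ls : List (Loop d)) :
    seqWeight K (LoopSeq.mk ls).minRep = seqWeight K ls := by
  rw [LoopSeq.minRep_mk]
  exact prod_map_dropNull (g := fun l => loopWeight K l.length) (loopWeight_zero K) ls

theorem seqWeight_pos {K : ℝ} (hK : 0 < K) (ls : List (Loop d)) : 0 < seqWeight K ls := by
  refine List.prod_pos fun a ha => ?_
  obtain ⟨l, -, rfl⟩ := List.mem_map.mp ha
  exact loopWeight_pos hK _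

theorem pow_length_le_seqWeight {L : ℝ} (hL : 0 ≤ L) (s : LoopSeq d) :
    L ^ s.length ≤ seqWeight (256 * L) s.minRep := by
  unfold LoopSeq.length
  induction s.minRep with
  | nil => simp [seqWeight]
  | cons l ls ih =>
    rw [seqWeight_cons, List.map_cons, List.sum_cons, pow_add]
    have h := pow_le_loopWeight hL l.length
    exact mul_le_mul h ih (by positivity) ((pow_nonneg hL _).trans h)

/-! ### Contraction -/

section Contraction

variable {K M : ℝ} {D : LoopSeq d → ℝ}

theorem abs_splittingTerm_le (hK : 64 ≤ K) (hM : 0 ≤ M)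
    (hD : ∀ s, |D s| ≤ M * seqWeight K s.minRep) (ρ : List (Edge d)) (e : Edge d)
    (ls : List (Loop d)) :
    |splittingTerm D ρ e ls| ≤ ((locs ρ e ∪ locs ρ e.inv).card : ℝ) *
      (M * seqWeight K ls * (loopWeight K ρ.length / 4)) := by
  have hK0 : 0 < K := by linarith
  set A := locs ρ e with hA
  set B := locs ρ e.inv with hB
  set c := M * seqWeight K ls with hc
  have hc0 : 0 ≤ c := mul_nonneg hM (seqWeight_pos hK0 ls).le
  have hAr : A ⊆ Finset.range ρ.length := Finset.filter_subset _ _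
  have hBr : B ⊆ Finset.range ρ.length := Finset.filter_subset _ _
  have hAB : Disjoint A B := disjoint_locs_inv ρ e
  have hD' : ∀ l l' : Loop d, ∀ x y, loopWeight K l.length * loopWeight K l'.length ≤
      splitWeight K ρ.length x y → |D (.mk (l :: l' :: ls))| ≤ c * splitWeight K ρ.length x y := by
    intro l l' x y h
    refine (hD _).trans ?_
    rw [seqWeight_minRep_mk, seqWeight_cons, seqWeight_cons, ← mul_assoc (loopWeight K _),
      mul_comm _ (seqWeight K ls), ← mul_assoc]
    exact mul_le_mul_of_nonneg_left h hc0
  have hneg : ∀ S T : Finset ℕ, S ⊆ Finset.range ρ.length → T ⊆ Finset.range ρ.length →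
      |∑ x ∈ S, ∑ y ∈ T, D (.mk ((negSplit ρ x y).1 :: (negSplit ρ x y).2 :: ls))| ≤
        ∑ x ∈ S, ∑ y ∈ T, c * splitWeight K ρ.length x y := by
    intro S T hS hT
    refine (Finset.abs_sum_le_sum_abs _ _).trans (Finset.sum_le_sum fun x hx => ?_)
    refine (Finset.abs_sum_le_sum_abs _ _).trans (Finset.sum_le_sum fun y hy => ?_)
    exact hD' _ _ _ _ (loopWeight_negSplit_le hK (Finset.mem_range.mp (hS hx))
      (Finset.mem_range.mp (hT hy)))
  have hps : ∀ f : Edge d, ∀ S : Finset ℕ, S ⊆ Finset.range ρ.length →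
      |∑ x ∈ S, ∑ y ∈ S.erase x, D (.mk ((posSplit ρ f x y).1 :: (posSplit ρ f x y).2 :: ls))| ≤
        ∑ x ∈ S, ∑ y ∈ S.erase x, c * splitWeight K ρ.length x y := by
    intro f S hS
    refine (Finset.abs_sum_le_sum_abs _ _).trans (Finset.sum_le_sum fun x hx => ?_)
    refine (Finset.abs_sum_le_sum_abs _ _).trans (Finset.sum_le_sum fun y hy => ?_)
    exact hD' _ _ _ _ (loopWeight_posSplit_le hK f (Finset.mem_range.mp (hS hx))
      (Finset.mem_range.mp (hS (Finset.mem_of_mem_erase hy))) (Finset.ne_of_mem_erase hy).symm)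
  -- For x in A the negative splittings use y in B and the positive ones y in A other than x. These
  -- sets are disjoint and avoid x, so both kinds together are covered by a single sum over y ≠ x
  -- and cost only one quarter.
  have hrow : ∀ S T : Finset ℕ, S ⊆ Finset.range ρ.length → T ⊆ Finset.range ρ.length →
      Disjoint S T →
      ∑ x ∈ S, ∑ y ∈ T, c * splitWeight K ρ.length x y +
        ∑ x ∈ S, ∑ y ∈ S.erase x, c * splitWeight K ρ.length x y ≤
      (S.card : ℝ) * (c * (loopWeight K ρ.length / 4)) := by
    intro S T hS hT hST
    rw [← Finset.sum_add_distrib, ← nsmul_eq_mul]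
    refine Finset.sum_le_card_nsmul _ _ _ fun x hx => ?_
    rw [← Finset.sum_union (hST.symm.mono_right (Finset.erase_subset _ _)), ← Finset.mul_sum]
    refine mul_le_mul_of_nonneg_left (le_trans ?_
      (sum_splitWeight_le hK0 (Finset.mem_range.mp (hS hx)))) hc0
    refine Finset.sum_le_sum_of_subset_of_nonneg ?_ fun _ _ _ => splitWeight_nonneg hK0 _ _ _
    intro y hy
    rcases Finset.mem_union.mp hy with hy | hy
    · exact Finset.mem_erase.mpr ⟨fun h => Finset.disjoint_left.mp hST hx (h ▸ hy), hT hy⟩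
    · exact Finset.mem_erase.mpr ⟨Finset.ne_of_mem_erase hy, hS (Finset.mem_of_mem_erase hy)⟩
  have h1 := abs_le.mp (hneg A B hAr hBr)
  have h2 := abs_le.mp (hneg B A hBr hAr)
  have h3 := abs_le.mp (hps e A hAr)
  have h4 := abs_le.mp (hps e.inv B hBr)
  have h5 := hrow A B hAr hBr hAB
  have h6 := hrow B A hBr hAr hAB.symm
  rw [Finset.card_union_of_disjoint hAB, Nat.cast_add, add_mul]
  unfold splittingTerm
  simp only [← hA, ← hB]
  rw [abs_le]
  constructor <;> linarith [h1.1, h1.2, h2.1, h2.2, h3.1, h3.2, h4.1, h4.2]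

/-- Each location admits at most P plaquettes and two signs of deformation, hence the factor 2P;
both deformations add at most four edges. -/
theorem abs_deformationTerm_le (hK : 64 ≤ K) (hM : 0 ≤ M)
    (hD : ∀ s, |D s| ≤ M * seqWeight K s.minRep) (β : ℝ) (ρ : List (Edge d)) (e : Edge d)
    (ls : List (Loop d)) {P : ℕ} (hP : (plaquettesAt e).card ≤ P) :
    |deformationTerm β D ρ e ls| ≤ ((locs ρ e ∪ locs ρ e.inv).card : ℝ) *
      (M * seqWeight K ls * (2 * |β| * P * loopWeight K (ρ.length + 4))) := by
  have hK0 : 0 < K := by linarith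
  set A := locs ρ e with hA
  set B := locs ρ e.inv with hB
  set c := M * seqWeight K ls with hc
  have hc0 : 0 ≤ c := mul_nonneg hM (seqWeight_pos hK0 ls).le
  have hw := (loopWeight_pos hK0 (ρ.length + 4)).le
  have hAr : A ⊆ Finset.range ρ.length := Finset.filter_subset _ _
  have hBr : B ⊆ Finset.range ρ.length := Finset.filter_subset _ _
  have hD' : ∀ l : Loop d, l.length ≤ ρ.length + 4 →
      |D (.mk (l :: ls))| ≤ c * loopWeight K (ρ.length + 4) := by
    intro l h
    refine (hD _).trans ?_
    rw [seqWeight_minRep_mk, seqWeight_cons, mul_comm _ (seqWeight K ls), ← mul_assoc]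
    exact mul_le_mul_of_nonneg_left (loopWeight_mono hK h) hc0
  have hsum : ∀ g h : List (Edge d) → ℕ → Loop d,
      (∀ p ∈ plaquettesAt e, ∀ x ∈ A, (g p x).length ≤ ρ.length + 4) →
      (∀ p ∈ plaquettesAt e, ∀ x ∈ B, (h p x).length ≤ ρ.length + 4) →
      |∑ p ∈ plaquettesAt e, ((∑ x ∈ A, D (.mk (g p x :: ls))) +
        ∑ x ∈ B, D (.mk (h p x :: ls)))| ≤
      P * (((A ∪ B).card : ℝ) * (c * loopWeight K (ρ.length + 4))) := by
    intro g h hg hh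
    have hb : ∀ p ∈ plaquettesAt e, |(∑ x ∈ A, D (.mk (g p x :: ls))) +
        ∑ x ∈ B, D (.mk (h p x :: ls))| ≤
        ((A ∪ B).card : ℝ) * (c * loopWeight K (ρ.length + 4)) := by
      intro p hp
      rw [Finset.card_union_of_disjoint (disjoint_locs_inv ρ e), Nat.cast_add, add_mul]
      refine (abs_add_le _ _).trans (add_le_add ?_ ?_)
      · refine (Finset.abs_sum_le_sum_abs _ _).trans ?_
        rw [← nsmul_eq_mul]
        exact Finset.sum_le_card_nsmul _ _ _ fun x hx => hD' _ (hg p hp x hx)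
      · refine (Finset.abs_sum_le_sum_abs _ _).trans ?_
        rw [← nsmul_eq_mul]
        exact Finset.sum_le_card_nsmul _ _ _ fun x hx => hD' _ (hh p hp x hx)
    refine (Finset.abs_sum_le_sum_abs _ _).trans ((Finset.sum_le_card_nsmul _ _ _ hb).trans ?_)
    rw [nsmul_eq_mul]
    exact mul_le_mul_of_nonneg_right (by exact_mod_cast hP) (by positivity)
  have hp' : ∀ p, p ∈ plaquettesAt e → p ∈ plaquettesAt e.inv :=
    fun p hp => (plaquettesAt_inv e).symm ▸ hp
  have h1 := hsum (fun p x => negDeform ρ e x p) (fun p x => negDeform ρ e.inv x p)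
    (fun p hp x hx => length_negDeform_le (Finset.mem_range.mp (hAr hx)) hp)
    (fun p hp x hx => length_negDeform_le (Finset.mem_range.mp (hBr hx)) (hp' p hp))
  have h2 := hsum (fun p x => posDeform ρ e x p) (fun p x => posDeform ρ e.inv x p)
    (fun p hp x hx => length_posDeform_le (Finset.mem_range.mp (hAr hx)) hp)
    (fun p hp x hx => length_posDeform_le (Finset.mem_range.mp (hBr hx)) (hp' p hp))
  unfold deformationTerm
  simp only [← hA, ← hB]
  refine (abs_sub _ _).trans ?_
  rw [abs_mul, abs_mul]
  refine (add_le_add (mul_le_mul_of_nonneg_left h1 (abs_nonneg β))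
    (mul_le_mul_of_nonneg_left h2 (abs_nonneg β))).trans (le_of_eq ?_)
  ring

/-- Splittings and deformations each give at most a quarter of the weight per location, and the
factor m on both sides cancels. It is positive because the first edge itself is a location. -/
theorem contraction (hK : 64 ≤ K) (hM : 0 ≤ M) {P : ℕ}
    (hP : ∀ e : Edge d, (plaquettesAt e).card ≤ P) {β : ℝ} (hβ : 2 * |β| * P * K ^ 4 ≤ 1 / 4)
    {R : FirstEdgeRule d} (h0 : D LoopSeq.null = 0) (hDeq : MasterLoopEq R β D)
    (hD : ∀ s, |D s| ≤ M * seqWeight K s.minRep) (s : LoopSeq d) :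
    |D s| ≤ M / 2 * seqWeight K s.minRep := by
  have hK0 : 0 < K := by linarith
  rcases hs : s.minRep with _ | ⟨l, ls⟩
  · rw [← LoopSeq.mk_minRep s, hs]
    have : (LoopSeq.mk [] : LoopSeq d) = LoopSeq.null := by
      rw [← LoopSeq.mk_minRep LoopSeq.null, LoopSeq.minRep_null]
    rw [this, h0, abs_zero]
    exact mul_nonneg (by linarith) (seqWeight_pos hK0 _).le
  · have hl : l ≠ Loop.null := LoopSeq.ne_null_of_mem_minRep (s := s) (by simp [hs])
    have hlen := Loop.length_eq (R.path_mem l)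
    have hpos := Loop.length_pos hl
    rcases hρ : R.path l with _ | ⟨e, τ⟩
    · rw [hlen, hρ] at hpos
      exact absurd hpos (lt_irrefl _)
    · have heq := hDeq s l ls hs e τ hρ
      set ρ := R.path l
      set m : ℝ := ((locs ρ e ∪ locs ρ e.inv).card : ℝ) with hm
      have hm0 : 0 < m := by
        rw [hm, Nat.cast_pos, Finset.card_pos]
        exact ⟨0, Finset.mem_union_left _ (mem_locs.mpr (by rw [hρ]; rfl))⟩
      have h1 := abs_splittingTerm_le hK hM hD ρ e ls
      have h2 := abs_deformationTerm_le hK hM hD β ρ e ls (hP e)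
      have h3 : 2 * |β| * P * loopWeight K (ρ.length + 4) ≤ loopWeight K ρ.length / 4 := by
        have hw := (loopWeight_pos hK0 ρ.length).le
        calc _ ≤ 2 * |β| * P * (K ^ 4 * loopWeight K ρ.length) := by
              gcongr
              exact loopWeight_add_four_le hK0 (hlen ▸ hpos)
          _ = (2 * |β| * P * K ^ 4) * loopWeight K ρ.length := by ring
          _ ≤ 1 / 4 * loopWeight K ρ.length := by gcongr
          _ = _ := by ring
      have hc0 : 0 ≤ M * seqWeight K ls := mul_nonneg hM (seqWeight_pos hK0 ls).le
      have h4 : m * |D s| ≤ m * (M / 2 * seqWeight K (l :: ls)) := by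
        rw [← abs_of_pos hm0, ← abs_mul, heq, abs_of_pos hm0, seqWeight_cons, hlen]
        refine (abs_add_le _ _).trans ((add_le_add h1 (h2.trans (mul_le_mul_of_nonneg_left
          (mul_le_mul_of_nonneg_left h3 hc0) hm0.le))).trans (le_of_eq ?_))
        rw [← hm]
        ring
      exact le_of_mul_le_mul_left h4 hm0

end Contraction

/-! ### Uniqueness of exponentially bounded solutions -/

/-- A splitting enters as the value at a longer sequence, not as a product of values at single
loops, so the equation is linear. -/
theorem MasterLoopEq.sub {R : FirstEdgeRule d} {β : ℝ} {φ ψ : LoopSeq d → ℝ}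
    (hφ : MasterLoopEq R β φ) (hψ : MasterLoopEq R β ψ) :
    MasterLoopEq R β (fun s => φ s - ψ s) := by
  intro s l ls hs e τ hρ
  have h1 := hφ s l ls hs e τ hρ
  have h2 := hψ s l ls hs e τ hρ
  simp only [splittingTerm, deformationTerm, Finset.sum_sub_distrib, Finset.sum_add_distrib]
    at h1 h2 ⊢
  rw [mul_sub, h1, h2]
  ring

/-- For small `β` the master loop equation has at most one solution of exponential growth. -/
theorem exists_unique_bound (d : ℕ) {L : ℝ} (hL : 1 ≤ L) : ∃ β₀ : ℝ, 0 < β₀ ∧ ∀ β : ℝ, |β| ≤ β₀ →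
    ∀ (R : FirstEdgeRule d) (φ ψ : LoopSeq d → ℝ), IsMasterSolution R L β φ →
      IsMasterSolution R L β ψ → φ = ψ := by
  obtain ⟨P, hP⟩ := exists_card_plaquettesAt_le d
  set K := 256 * L with hK
  have hK64 : 64 ≤ K := by linarith
  have hK0 : 0 < K := by linarith
  -- This is the smallness 2|β| P K⁴ ≤ 1/4 asked for by the contraction, with P + 1 in place of P to
  -- keep the denominator positive.
  refine ⟨1 / (8 * (P + 1) * K ^ 4), by positivity, fun β hβ R φ ψ hφ hψ => ?_⟩
  have hβ' : 2 * |β| * P * K ^ 4 ≤ 1 / 4 := by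
    rw [le_div_iff₀ (by positivity)] at hβ
    have : 0 ≤ |β| * K ^ 4 := by positivity
    nlinarith
  have key : ∀ k : ℕ, ∀ s, |φ s - ψ s| ≤ 2 / 2 ^ k * seqWeight K s.minRep := by
    intro k
    induction k with
    | zero =>
      intro s
      have h1 := hφ.bound s
      have h2 := hψ.bound s
      have h3 := pow_length_le_seqWeight (by linarith : 0 ≤ L) s
      have := abs_sub (φ s) (ψ s)
      rw [pow_zero, div_one]
      linarith
    | succ k ih =>
      intro s
      have := contraction hK64 (by positivity) hP hβ'
        (by rw [hφ.null, hψ.null, sub_self]) (hφ.master.sub hψ.master) ih s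
      rwa [div_div, ← pow_succ] at this
  funext s
  have hlim : Tendsto (fun k : ℕ => 2 / 2 ^ k * seqWeight K s.minRep) atTop (𝓝 0) := by
    have h := (tendsto_pow_atTop_nhds_zero_of_lt_one (r := (1 / 2 : ℝ)) (by norm_num)
      (by norm_num)).const_mul (2 * seqWeight K s.minRep)
    rw [mul_zero] at h
    refine h.congr fun k => ?_
    rw [one_div, inv_pow]
    ring
  have h := ge_of_tendsto' hlim (fun k => key k s)
  exact sub_eq_zero.mp (abs_nonpos_iff.mp h)

/-! ### Haar measure on `SO(N)` and on configurations -/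

instance (N : ℕ) : SecondCountableTopology (SO N) :=
  have : SecondCountableTopology (Matrix (Fin N) (Fin N) ℝ) :=
    inferInstanceAs (SecondCountableTopology (Fin N → Fin N → ℝ))
  TopologicalSpace.Subtype.secondCountableTopology _

instance (N : ℕ) : IsProbabilityMeasure (haarSO N) :=
  ⟨by unfold haarSO; exact Measure.haarMeasure_self⟩

instance (N : ℕ) : (haarSO N).IsHaarMeasure := by unfold haarSO; infer_instance

/-- A right translate of the Haar probability measure is again a Haar probability measure, hence
equal to it. -/
instance (N : ℕ) : (haarSO N).IsMulRightInvariant := ⟨fun g => by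
  have : IsProbabilityMeasure ((haarSO N).map (· * g)) :=
    Measure.isProbabilityMeasure_map (measurable_mul_const g).aemeasurable
  exact Measure.isHaarMeasure_eq_of_isProbabilityMeasure _ _⟩

/-- The product of the Haar measures. -/
noncomputable abbrev haarConfig (Λ : Finset (Fin d → ℤ)) (N : ℕ) : Measure (Config Λ N) :=
  Measure.pi fun _ : PosEdgeIn Λ => haarSO N

theorem integrable_haarConfig {f : Config Λ N → ℝ} (hf : Continuous f) :
    Integrable f (haarConfig Λ N) :=
  hf.integrable_of_hasCompactSupport (HasCompactSupport.of_compactSpace f)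

theorem SO.coe_inv_eq_transpose (A : SO N) : (A⁻¹ : SO N).1 = A.1.transpose := by
  rw [SO.coe_inv, Matrix.star_eq_conjTranspose, Matrix.conjTranspose_eq_transpose_of_trivial]

theorem SO.abs_apply_le (A : SO N) (i j : Fin N) : |A.1 i j| ≤ 1 :=
  entry_norm_bound_of_unitary (𝕜 := ℝ) (Matrix.mem_specialOrthogonalGroup_iff.mp A.2).1 i j

theorem SO.abs_trace_le (A : SO N) : |A.1.trace| ≤ N := by
  refine (Finset.abs_sum_le_sum_abs _ _).trans
    ((Finset.sum_le_card_nsmul _ _ 1 fun i _ => A.abs_apply_le i i).trans ?_)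
  simp

/-! ### Generators of rotations -/

/-- The infinitesimal rotation in the coordinate plane `i, j`. -/
def rotGen (i j : Fin N) : Matrix (Fin N) (Fin N) ℝ := Matrix.single i j 1 - Matrix.single j i 1

theorem rotGen_transpose (i j : Fin N) : (rotGen i j).transpose = -rotGen i j := by
  simp [rotGen]

theorem trace_rotGen_mul (i j : Fin N) (P : Matrix (Fin N) (Fin N) ℝ) :
    (rotGen i j * P).trace = P j i - P i j := by
  simp [rotGen, sub_mul, Matrix.trace_sub, Matrix.trace_single_mul]

theorem trace_rotGen_mul_rotGen_mul (i j : Fin N) (P R : Matrix (Fin N) (Fin N) ℝ) :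
    (rotGen i j * P * rotGen i j * R).trace =
      P j i * R j i - P j j * R i i - P i i * R j j + P i j * R i j := by
  have h : ∀ a b k l : Fin N, (Matrix.single a b (1 : ℝ) * P * Matrix.single k l 1 * R).trace =
      P b k * R l a := by
    intro a b k l
    rw [Matrix.single_mul_mul_single, Matrix.trace_single_mul]
    simp
  simp only [rotGen, sub_mul, mul_sub, Matrix.trace_sub, h]
  ring

/-- Contraction identity for the Lie algebra so(N): two generators inside one trace cut it into a
product of two traces, up to a single-trace term. Summing over ordered pairs counts each plane
twice, hence the 2. -/
theorem sum_trace_rotGen_mul_rotGen (P R : Matrix (Fin N) (Fin N) ℝ) :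
    ∑ i, ∑ j, (rotGen i j * P * rotGen i j * R).trace =
      2 * ((P.transpose * R).trace - P.trace * R.trace) := by
  have h1 : (P.transpose * R).trace = ∑ i, ∑ j, P j i * R j i := by
    simp [Matrix.trace, Matrix.mul_apply]
  have h2 : (P.transpose * R).trace = ∑ i, ∑ j, P i j * R i j := by
    rw [h1, Finset.sum_comm]
  have h3 : P.trace * R.trace = ∑ i, ∑ j, P i i * R j j := by
    simp [Matrix.trace, Finset.sum_mul_sum]
  have h4 : P.trace * R.trace = ∑ i, ∑ j, P j j * R i i := by
    rw [h3, Finset.sum_comm]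
  simp only [trace_rotGen_mul_rotGen_mul, Finset.sum_add_distrib, Finset.sum_sub_distrib]
  linarith

/-- The companion identity: generators in two different traces join them into one. It turns
derivatives of the action into plaquette deformations. -/
theorem sum_trace_rotGen_mul_trace (P R : Matrix (Fin N) (Fin N) ℝ) :
    ∑ i, ∑ j, (rotGen i j * P).trace * (rotGen i j * R).trace =
      2 * ((P * R.transpose).trace - (P * R).trace) := by
  have h1 : (P * R.transpose).trace = ∑ i, ∑ j, P i j * R i j := by
    simp [Matrix.trace, Matrix.mul_apply]
  have h2 : (P * R.transpose).trace = ∑ i, ∑ j, P j i * R j i := by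
    rw [h1, Finset.sum_comm]
  have h3 : (P * R).trace = ∑ i, ∑ j, P i j * R j i := by
    simp [Matrix.trace, Matrix.mul_apply]
  have h4 : (P * R).trace = ∑ i, ∑ j, P j i * R i j := by
    rw [h3, Finset.sum_comm]
  simp only [trace_rotGen_mul, sub_mul, mul_sub, Finset.sum_sub_distrib]
  linarith

/-- The square of the generator is minus the projection onto the plane. This relation is what makes
the Rodrigues formula for `rotMatrix` a one-parameter group. -/
theorem rotGen_mul_self_mul_self (i j : Fin N) :
    rotGen i j * rotGen i j * rotGen i j = -rotGen i j := by
  by_cases h : i = j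
  · simp [rotGen, h]
  · simp [rotGen, sub_mul, mul_sub, Matrix.single_mul_single_of_ne, h, Ne.symm h]
    abel

/-- The rotation by the angle `t` in the coordinate plane `i, j`. -/
noncomputable def rotMatrix (i j : Fin N) (t : ℝ) : Matrix (Fin N) (Fin N) ℝ :=
  1 + Real.sin t • rotGen i j + (1 - Real.cos t) • (rotGen i j * rotGen i j)

theorem rotMatrix_zero (i j : Fin N) : rotMatrix i j 0 = 1 := by simp [rotMatrix]

theorem rotMatrix_add (i j : Fin N) (s t : ℝ) :
    rotMatrix i j (s + t) = rotMatrix i j s * rotMatrix i j t := by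
  have h3 := rotGen_mul_self_mul_self i j
  unfold rotMatrix
  set X := rotGen i j
  have h3' : X * (X * X) = -X := by rw [← mul_assoc, h3]
  have h4 : X * X * (X * X) = -(X * X) := by rw [← mul_assoc, h3, neg_mul]
  simp only [add_mul, mul_add, one_mul, mul_one, smul_mul_assoc, mul_smul_comm, h3, h3', h4,
    smul_neg, Real.sin_add, Real.cos_add]
  module

theorem rotMatrix_transpose (i j : Fin N) (t : ℝ) :
    (rotMatrix i j t).transpose = rotMatrix i j (-t) := by
  simp [rotMatrix, rotGen_transpose]

theorem rotMatrix_mem_orthogonalGroup (i j : Fin N) (t : ℝ) :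
    rotMatrix i j t ∈ Matrix.orthogonalGroup (Fin N) ℝ := by
  rw [Matrix.mem_orthogonalGroup_iff, rotMatrix_transpose, ← rotMatrix_add,
    add_neg_cancel, rotMatrix_zero]

/-- The determinant is 1 because the rotation is the square of the one by half the angle, and the
determinant of an orthogonal matrix squares to 1. -/
theorem rotMatrix_mem (i j : Fin N) (t : ℝ) :
    rotMatrix i j t ∈ Matrix.specialOrthogonalGroup (Fin N) ℝ := by
  refine Matrix.mem_specialOrthogonalGroup_iff.mpr ⟨rotMatrix_mem_orthogonalGroup i j t, ?_⟩
  have h := congrArg Matrix.det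
    ((Matrix.mem_orthogonalGroup_iff _ _).mp (rotMatrix_mem_orthogonalGroup i j (t / 2)))
  rw [Matrix.det_mul,
    Matrix.det_transpose, Matrix.det_one] at h
  rw [← add_halves t, rotMatrix_add, Matrix.det_mul, h]

/-- The rotation by the angle `t` in the coordinate plane `i, j`, as an element of `SO(N)`. -/
noncomputable def rotSO (i j : Fin N) (t : ℝ) : SO N := ⟨rotMatrix i j t, rotMatrix_mem i j t⟩

theorem rotSO_zero (i j : Fin N) : rotSO i j 0 = 1 := Subtype.ext (rotMatrix_zero i j)

theorem rotSO_add (i j : Fin N) (s t : ℝ) : rotSO i j (s + t) = rotSO i j s * rotSO i j t :=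
  Subtype.ext (rotMatrix_add i j s t)

/-! ### Entrywise derivatives at `0` -/

/-- The matrix valued function `f` has the entrywise derivative `f'` at `0`. -/
def HasEntryDeriv (f : ℝ → Matrix (Fin N) (Fin N) ℝ) (f' : Matrix (Fin N) (Fin N) ℝ) : Prop :=
  ∀ a b, HasDerivAt (fun t => f t a b) (f' a b) 0

theorem HasEntryDeriv.mul {f g : ℝ → Matrix (Fin N) (Fin N) ℝ}
    {f' g' : Matrix (Fin N) (Fin N) ℝ} (hf : HasEntryDeriv f f') (hg : HasEntryDeriv g g') :
    HasEntryDeriv (fun t => f t * g t) (f' * g 0 + f 0 * g') := by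
  intro a b
  simp only [Matrix.mul_apply, Matrix.add_apply, ← Finset.sum_add_distrib]
  exact HasDerivAt.fun_sum fun k _ => (hf a k).mul (hg k b)

theorem HasEntryDeriv.trace {f : ℝ → Matrix (Fin N) (Fin N) ℝ} {f' : Matrix (Fin N) (Fin N) ℝ}
    (hf : HasEntryDeriv f f') : HasDerivAt (fun t => (f t).trace) f'.trace 0 :=
  HasDerivAt.fun_sum fun k _ => hf k k

theorem hasEntryDeriv_const (A : Matrix (Fin N) (Fin N) ℝ) : HasEntryDeriv (fun _ => A) 0 :=
  fun a b => hasDerivAt_const 0 (A a b)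

theorem hasEntryDeriv_rotMatrix (i j : Fin N) : HasEntryDeriv (rotMatrix i j) (rotGen i j) := by
  intro a b
  have h1 := (Real.hasDerivAt_sin 0).mul_const (rotGen i j a b)
  have h2 := ((Real.hasDerivAt_cos 0).const_sub 1).mul_const ((rotGen i j * rotGen i j) a b)
  have h3 := (h1.const_add ((1 : Matrix (Fin N) (Fin N) ℝ) a b)).add h2
  simp only [Real.cos_zero, one_mul, Real.sin_zero, neg_zero, zero_mul, add_zero] at h3
  exact h3

theorem hasEntryDeriv_rotMatrix_inv (i j : Fin N) :
    HasEntryDeriv (fun t => ((rotSO i j t)⁻¹ : SO N).1) (-rotGen i j) := by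
  intro a b
  have h := hasEntryDeriv_rotMatrix i j b a
  rw [← rotGen_transpose]
  refine h.congr_of_eventuallyEq (Eventually.of_forall fun t => ?_)
  change ((rotSO i j t)⁻¹ : SO N).1 a b = _
  rw [SO.coe_inv_eq_transpose]
  rfl

/-! ### The action of `SO(N)` on one edge variable -/

open Classical in
/-- Left multiplication of the variable of the edge `e` by `g`. -/
noncomputable def act (e : Edge d) (g : SO N) (Q : Config Λ N) : Config Λ N :=
  (fun f : PosEdgeIn Λ => if f.1 = e then g else 1) * Q *
    -- Only one orientation of each edge is a coordinate. If it is e⁻¹, replacing Q_e by g Q_e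
    -- multiplies the coordinate on the right by g⁻¹. Writing the action as two translations of the
    -- product group makes invariance of the product Haar measure directly applicable.
    (fun f : PosEdgeIn Λ => if f.1 = e.inv then g⁻¹ else 1)

theorem act_one (e : Edge d) (Q : Config Λ N) : act e 1 Q = Q := by
  funext f; simp [act]

theorem act_mul (e : Edge d) (g h : SO N) (Q : Config Λ N) :
    act e (g * h) Q = act e g (act e h Q) := by
  funext f
  simp only [act, Pi.mul_apply]
  split_ifs <;> simp [mul_assoc]

theorem continuous_act (e : Edge d) (g : SO N) :
    Continuous (act e g : Config Λ N → Config Λ N) := by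
  unfold act
  fun_prop

theorem integral_act (e : Edge d) (g : SO N) (f : Config Λ N → ℝ) :
    ∫ Q, f (act e g Q) ∂(haarConfig Λ N) = ∫ Q, f Q ∂(haarConfig Λ N) := by
  unfold act
  rw [integral_mul_left_eq_self (μ := haarConfig Λ N) (fun Q : Config Λ N => f (Q * _)),
    integral_mul_right_eq_self (μ := haarConfig Λ N)]

theorem edgeVar_act_self {e : Edge d} (h1 : e.src ∈ Λ) (h2 : e.tgt ∈ Λ) (g : SO N)
    (Q : Config Λ N) : edgeVar (act e g Q) e = g * edgeVar Q e := by
  have h := e.isPos_inv_iff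
  unfold edgeVar
  by_cases hp : e.IsPos
  · simp [hp, h1, h2, act, e.ne_inv]
  · have h' : e.inv.IsPos := by tauto
    simp [hp, h', h1, h2, act, e.inv_ne]

theorem edgeVar_act_of_ne {e f : Edge d} (h1 : f ≠ e) (h2 : f ≠ e.inv) (g : SO N)
    (Q : Config Λ N) : edgeVar (act e g Q) f = edgeVar Q f := by
  have h3 : f.inv ≠ e := fun h => h2 (by rw [← h, Edge.inv_inv])
  have h4 : f.inv ≠ e.inv := fun h => h1 (Edge.inv_injective h)
  unfold edgeVar
  simp only [act, Pi.mul_apply, h1, h2, h3, h4, if_false, one_mul, mul_one]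

theorem edgeVar_act_inv {e : Edge d} (h1 : e.src ∈ Λ) (h2 : e.tgt ∈ Λ) (g : SO N)
    (Q : Config Λ N) : edgeVar (act e g Q) e.inv = edgeVar Q e.inv * g⁻¹ := by
  rw [edgeVar_inv, edgeVar_act_self h1 h2, edgeVar_inv, mul_inv_rev]

theorem continuous_edgeVar (f : Edge d) : Continuous fun Q : Config Λ N => edgeVar Q f := by
  unfold edgeVar
  split_ifs <;> fun_prop

theorem continuous_hol (ρ : List (Edge d)) : Continuous fun Q : Config Λ N => hol Q ρ := by
  induction ρ with
  | nil => exact continuous_const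
  | cons f t ih =>
    simp only [hol_cons]
    exact (continuous_edgeVar f).mul ih

theorem continuous_hol_val (ρ : List (Edge d)) :
    Continuous fun Q : Config Λ N => (hol Q ρ).1 :=
  continuous_subtype_val.comp (continuous_hol ρ)

theorem continuous_pathTrace (ρ : List (Edge d)) :
    Continuous fun Q : Config Λ N => pathTrace Q ρ :=
  (continuous_hol_val ρ).matrix_trace

/-! ### Lie derivatives -/

/-- `G'` is the derivative of `G` along the rotations of the variable of the edge `e` in the
coordinate plane `i, j`. -/
def HasLieDeriv (e : Edge d) (i j : Fin N) (G G' : Config Λ N → ℝ) : Prop :=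
  ∀ Q, HasDerivAt (fun t => G (act e (rotSO i j t) Q)) (G' Q) 0

theorem act_rotSO_zero (e : Edge d) (i j : Fin N) (Q : Config Λ N) :
    act e (rotSO i j 0) Q = Q := by rw [rotSO_zero, act_one]

theorem HasLieDeriv.mul {e : Edge d} {i j : Fin N} {G G' H H' : Config Λ N → ℝ}
    (hG : HasLieDeriv e i j G G') (hH : HasLieDeriv e i j H H') :
    HasLieDeriv e i j (fun Q => G Q * H Q) (fun Q => G' Q * H Q + G Q * H' Q) := by
  intro Q
  have := (hG Q).mul (hH Q)
  simp only [act_rotSO_zero] at this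
  exact this

/-- Integration by parts: the Lie derivative of a function has integral zero. -/
theorem HasLieDeriv.integral_eq_zero {e : Edge d} {i j : Fin N} {G G' : Config Λ N → ℝ}
    (h : HasLieDeriv e i j G G') (hG : Continuous G) (hG' : Continuous G') :
    ∫ Q, G' Q ∂(haarConfig Λ N) = 0 := by
  obtain ⟨C, hC⟩ := isCompact_univ.exists_bound_of_continuousOn hG'.continuousOn
  -- The hypothesis gives the derivative only at t = 0; the one-parameter group law carries it to
  -- every t, as differentiation under the integral requires.
  have hd : ∀ Q : Config Λ N, ∀ t : ℝ, HasDerivAt (fun s => G (act e (rotSO i j s) Q))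
      (G' (act e (rotSO i j t) Q)) t := by
    intro Q t
    have h1 := h (act e (rotSO i j t) Q)
    have h2 : HasDerivAt (fun s => G (act e (rotSO i j (s - t)) (act e (rotSO i j t) Q)))
        (G' (act e (rotSO i j t) Q)) t := by
      have := HasDerivAt.comp_sub_const t t (f := fun s => G (act e (rotSO i j s)
        (act e (rotSO i j t) Q))) (f' := G' (act e (rotSO i j t) Q)) (by rwa [sub_self])
      exact this
    refine h2.congr_of_eventuallyEq (Eventually.of_forall fun s => ?_)
    simp only [← act_mul, ← rotSO_add, sub_add_cancel]
  have h3 := (hasDerivAt_integral_of_dominated_loc_of_deriv_le (μ := haarConfig Λ N)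
    (F := fun t Q => G (act e (rotSO i j t) Q)) (F' := fun t Q => G' (act e (rotSO i j t) Q))
    (x₀ := (0 : ℝ)) (s := Set.univ) (bound := fun _ => C) Filter.univ_mem
    (Eventually.of_forall fun t =>
      (integrable_haarConfig (hG.comp (continuous_act e _))).aestronglyMeasurable)
    (integrable_haarConfig (hG.comp (continuous_act e _)))
    (integrable_haarConfig (hG'.comp (continuous_act e _))).aestronglyMeasurable
    (Eventually.of_forall fun Q t _ => hC _ trivial) (integrable_const C)
    (Eventually.of_forall fun Q t _ => hd Q t)).2
  -- By invariance the differentiated integral is constant in t.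
  simp only [integral_act] at h3
  exact h3.unique (hasDerivAt_const _ _)

open Classical in
/-- The derivative of the edge variable of `f` along `X` at the edge `e`. -/
noncomputable def dEdge (e : Edge d) (X : Matrix (Fin N) (Fin N) ℝ) (Q : Config Λ N)
    (f : Edge d) : Matrix (Fin N) (Fin N) ℝ :=
  if f = e then X * (edgeVar Q f).1 else if f = e.inv then -((edgeVar Q f).1 * X) else 0

/-- The derivative of the holonomy along `X` at the edge `e`. -/
noncomputable def dHol (e : Edge d) (X : Matrix (Fin N) (Fin N) ℝ) (Q : Config Λ N) :
    List (Edge d) → Matrix (Fin N) (Fin N) ℝ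
  | [] => 0
  | f :: t => dEdge e X Q f * (hol Q t).1 + (edgeVar Q f).1 * dHol e X Q t

theorem continuous_dHol (e : Edge d) (X : Matrix (Fin N) (Fin N) ℝ) (ρ : List (Edge d)) :
    Continuous fun Q : Config Λ N => dHol e X Q ρ := by
  induction ρ with
  | nil => exact continuous_const
  | cons f t ih =>
    have h1 : Continuous fun Q : Config Λ N => (edgeVar Q f).1 :=
      continuous_subtype_val.comp (continuous_edgeVar f)
    have h2 : Continuous fun Q : Config Λ N => dEdge e X Q f := by
      unfold dEdge
      split_ifs
      · exact continuous_const.matrix_mul h1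
      · exact (h1.matrix_mul continuous_const).neg
      · exact continuous_const
    exact (h2.matrix_mul (continuous_hol_val t)).add (h1.matrix_mul ih)

theorem hasEntryDeriv_edgeVar {e : Edge d} (h1 : e.src ∈ Λ) (h2 : e.tgt ∈ Λ) (i j : Fin N)
    (Q : Config Λ N) (f : Edge d) :
    HasEntryDeriv (fun t => (edgeVar (act e (rotSO i j t) Q) f).1)
      (dEdge e (rotGen i j) Q f) := by
  unfold dEdge
  split_ifs with hf hf'
  · subst hf
    have := (hasEntryDeriv_rotMatrix i j).mul (hasEntryDeriv_const (edgeVar Q f).1)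
    rw [mul_zero, add_zero] at this
    simp only [edgeVar_act_self h1 h2]
    exact this
  · subst hf'
    have := (hasEntryDeriv_const (edgeVar Q e.inv).1).mul (hasEntryDeriv_rotMatrix_inv i j)
    rw [zero_mul, zero_add, mul_neg] at this
    simp only [edgeVar_act_inv h1 h2]
    exact this
  · simp only [edgeVar_act_of_ne hf hf']
    exact hasEntryDeriv_const _

theorem hasEntryDeriv_hol {e : Edge d} (h1 : e.src ∈ Λ) (h2 : e.tgt ∈ Λ) (i j : Fin N)
    (Q : Config Λ N) (ρ : List (Edge d)) :
    HasEntryDeriv (fun t => (hol (act e (rotSO i j t) Q) ρ).1) (dHol e (rotGen i j) Q ρ) := by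
  induction ρ with
  | nil => exact hasEntryDeriv_const _
  | cons f t ih =>
    have := (hasEntryDeriv_edgeVar h1 h2 i j Q f).mul ih
    simp only [act_rotSO_zero] at this
    simp only [hol_cons]
    exact this

/-- Leibniz rule. At e the generator is inserted in front of the edge; at e⁻¹, where Q_e⁻¹ becomes
Q_e⁻¹ g⁻¹, it is inserted behind the edge with a minus sign. Hence the cut at y in one sum and at y
+ 1 in the other. -/
theorem dHol_eq_sum (e : Edge d) (X : Matrix (Fin N) (Fin N) ℝ) (Q : Config Λ N)
    (ρ : List (Edge d)) :
    dHol e X Q ρ = ∑ y ∈ locs ρ e, (hol Q (ρ.take y)).1 * X * (hol Q (ρ.drop y)).1 -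
      ∑ y ∈ locs ρ e.inv, (hol Q (ρ.take (y + 1))).1 * X * (hol Q (ρ.drop (y + 1))).1 := by
  induction ρ with
  | nil => simp [dHol, locs]
  | cons f t ih =>
    have hc : ∀ ρ : List (Edge d), (hol Q (f :: ρ)).1 = (edgeVar Q f).1 * (hol Q ρ).1 :=
      fun ρ => by rw [hol_cons]; rfl
    rw [sum_locs_cons, sum_locs_cons, dHol, ih]
    have h1 : ∀ y, 1 + y = y + 1 := Nat.add_comm 1
    simp only [h1]
    simp only [zero_add, List.take_succ_cons, List.drop_succ_cons, hc, List.take_zero,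
      List.drop_zero, mul_sub, Finset.mul_sum, mul_assoc, dEdge]
    by_cases hf : f = e
    · subst hf
      simp [f.ne_inv, mul_assoc]
      abel
    · by_cases hf' : f = e.inv
      · subst hf'
        simp [e.inv_ne, mul_assoc]
        abel
      · simp [hf, hf']

/-! ### The Schwinger-Dyson equation at one location -/

theorem card_locs_le (ρ : List (Edge d)) (e : Edge d) : (locs ρ e).card ≤ ρ.length :=
  (Finset.card_filter_le _ _).trans (by simp)

theorem hol_append_val (Q : Config Λ N) (ρ ρ' : List (Edge d)) :
    (hol Q (ρ ++ ρ')).1 = (hol Q ρ).1 * (hol Q ρ').1 := by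
  rw [hol_append]; rfl

theorem trace_dHol (e : Edge d) (X : Matrix (Fin N) (Fin N) ℝ) (Q : Config Λ N)
    (ρ : List (Edge d)) :
    (dHol e X Q ρ).trace = ∑ y ∈ locs ρ e, (X * (hol Q (ρ.drop y ++ ρ.take y)).1).trace -
      ∑ y ∈ locs ρ e.inv, (X * (hol Q (ρ.drop (y + 1) ++ ρ.take (y + 1))).1).trace := by
  have h : ∀ A B : Matrix (Fin N) (Fin N) ℝ, (A * X * B).trace = (X * (B * A)).trace := by
    intro A B
    rw [mul_assoc, Matrix.trace_mul_comm, mul_assoc]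
  simp only [dHol_eq_sum, Matrix.trace_sub, Matrix.trace_sum, h, hol_append_val]

theorem abs_trace_rotGen_mul_le (i j : Fin N) (A : SO N) : |(rotGen i j * A.1).trace| ≤ 2 := by
  rw [trace_rotGen_mul]
  have h1 := abs_le.mp (A.abs_apply_le i j)
  have h2 := abs_le.mp (A.abs_apply_le j i)
  rw [abs_le]
  constructor <;> linarith [h1.1, h1.2, h2.1, h2.2]

theorem abs_sum_locs_le {c : ℝ} (hc : 0 ≤ c) (ρ : List (Edge d)) (e : Edge d) (G : ℕ → ℝ)
    (hG : ∀ y, |G y| ≤ c) : |∑ y ∈ locs ρ e, G y| ≤ ρ.length * c := by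
  refine (Finset.abs_sum_le_sum_abs _ _).trans
    ((Finset.sum_le_card_nsmul _ _ c fun y _ => hG y).trans ?_)
  rw [nsmul_eq_mul]
  exact mul_le_mul_of_nonneg_right (by exact_mod_cast card_locs_le ρ e) hc

theorem abs_trace_dHol_le (e : Edge d) (i j : Fin N) (Q : Config Λ N) (ρ : List (Edge d)) :
    |(dHol e (rotGen i j) Q ρ).trace| ≤ 4 * ρ.length := by
  rw [trace_dHol]
  have h1 := abs_sum_locs_le zero_le_two ρ e _
    fun y => abs_trace_rotGen_mul_le i j (hol Q (ρ.drop y ++ ρ.take y))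
  have h2 := abs_sum_locs_le zero_le_two ρ e.inv _
    fun y => abs_trace_rotGen_mul_le i j (hol Q (ρ.drop (y + 1) ++ ρ.take (y + 1)))
  refine (abs_sub _ _).trans ?_
  linarith

theorem sum_trace_rotGen_mul_dHol (e : Edge d) (Q : Config Λ N) (ρ : List (Edge d)) :
    ∑ i, ∑ j, (rotGen i j * dHol e (rotGen i j) Q ρ).trace =
      2 * ((∑ y ∈ locs ρ e, (((hol Q (ρ.take y))⁻¹ * hol Q (ρ.drop y) : SO N).1.trace -
        pathTrace Q (ρ.take y) * pathTrace Q (ρ.drop y))) -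
      ∑ y ∈ locs ρ e.inv, (((hol Q (ρ.take (y + 1)))⁻¹ * hol Q (ρ.drop (y + 1)) : SO N).1.trace -
        pathTrace Q (ρ.take (y + 1)) * pathTrace Q (ρ.drop (y + 1)))) := by
  have key : ∀ (S : Finset ℕ) (g h : ℕ → SO N),
      ∑ i, ∑ j, ∑ y ∈ S, (rotGen i j * ((g y).1 * rotGen i j * (h y).1)).trace =
      2 * ∑ y ∈ S, (((g y)⁻¹ * h y : SO N).1.trace - (g y).1.trace * (h y).1.trace) := by
    intro S g h
    have h1 : ∀ y, ((g y)⁻¹ * h y : SO N).1 = (g y).1.transpose * (h y).1 := by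
      intro y
      rw [← SO.coe_inv_eq_transpose]; rfl
    simp only [h1, Finset.mul_sum, ← sum_trace_rotGen_mul_rotGen]
    simp only [Finset.sum_comm (t := S), ← mul_assoc]
  simp only [dHol_eq_sum, mul_sub, Matrix.trace_sub, Finset.sum_sub_distrib, Finset.mul_sum,
    Matrix.trace_sum]
  rw [key (locs ρ e) (fun y => hol Q (ρ.take y)) (fun y => hol Q (ρ.drop y)),
    key (locs ρ e.inv) (fun y => hol Q (ρ.take (y + 1))) (fun y => hol Q (ρ.drop (y + 1)))]
  simp only [pathTrace_eq, Finset.sum_sub_distrib, mul_sub, Finset.mul_sum]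

/-- The deformations of the word `w` by the plaquette `p`, in terms of traces. -/
noncomputable def plaqTerm (Q : Config Λ N) (e : Edge d) (w p : List (Edge d)) : ℝ :=
  ∑ y ∈ locs p e, (pathTrace Q (w ++ invPath (p.drop y ++ p.take y)) -
    pathTrace Q (w ++ (p.drop y ++ p.take y))) -
  ∑ y ∈ locs p e.inv, (pathTrace Q (w ++ invPath (p.drop (y + 1) ++ p.take (y + 1))) -
    pathTrace Q (w ++ (p.drop (y + 1) ++ p.take (y + 1))))

theorem sum_trace_rotGen_mul_trace_dHol (e : Edge d) (Q : Config Λ N) (w p : List (Edge d)) :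
    ∑ i, ∑ j, (rotGen i j * (hol Q w).1).trace * (dHol e (rotGen i j) Q p).trace =
      2 * plaqTerm Q e w p := by
  have key : ∀ (S : Finset ℕ) (r : ℕ → List (Edge d)),
      ∑ i, ∑ j, ∑ y ∈ S, (rotGen i j * (hol Q w).1).trace * (rotGen i j * (hol Q (r y)).1).trace =
      2 * ∑ y ∈ S, (pathTrace Q (w ++ invPath (r y)) - pathTrace Q (w ++ r y)) := by
    intro S r
    simp only [pathTrace_eq, hol_append_val, hol_invPath, SO.coe_inv_eq_transpose, Finset.mul_sum,
      ← sum_trace_rotGen_mul_trace]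
    simp only [Finset.sum_comm (t := S)]
  simp only [trace_dHol, mul_sub, Finset.sum_sub_distrib, Finset.mul_sum]
  rw [key (locs p e) (fun y => p.drop y ++ p.take y),
    key (locs p e.inv) (fun y => p.drop (y + 1) ++ p.take (y + 1)), plaqTerm]
  ring

/-! ### Products of normalized Wilson loops and their derivatives -/

/-- The normalized Wilson loop variable of a path. -/
noncomputable def normTrace (Q : Config Λ N) (ρ : List (Edge d)) : ℝ := pathTrace Q ρ / N

theorem abs_normTrace_le (Q : Config Λ N) (ρ : List (Edge d)) : |normTrace Q ρ| ≤ 1 := by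
  rw [normTrace, abs_div, Nat.abs_cast]
  exact div_le_one_of_le₀ (SO.abs_trace_le _) (Nat.cast_nonneg _)

theorem continuous_normTrace (ρ : List (Edge d)) :
    Continuous fun Q : Config Λ N => normTrace Q ρ :=
  (continuous_pathTrace ρ).div_const _

/-- The product of the normalized Wilson loop variables of a sequence of paths. -/
noncomputable def normProd (Q : Config Λ N) (ps : List (List (Edge d))) : ℝ :=
  (ps.map (normTrace Q)).prod

theorem normProd_cons (Q : Config Λ N) (p : List (Edge d)) (ps : List (List (Edge d))) :
    normProd Q (p :: ps) = normTrace Q p * normProd Q ps := by simp [normProd]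

theorem abs_normProd_le (Q : Config Λ N) (ps : List (List (Edge d))) : |normProd Q ps| ≤ 1 := by
  induction ps with
  | nil => simp [normProd]
  | cons p ps ih =>
    rw [normProd_cons, abs_mul]
    exact mul_le_one₀ (abs_normTrace_le Q p) (abs_nonneg _) ih

theorem continuous_normProd (ps : List (List (Edge d))) :
    Continuous fun Q : Config Λ N => normProd Q ps := by
  induction ps with
  | nil => exact continuous_const
  | cons p ps ih =>
    simp only [normProd_cons]
    exact (continuous_normTrace p).mul ih

/-- The derivative of `normProd`. -/
noncomputable def dNormProd (e : Edge d) (X : Matrix (Fin N) (Fin N) ℝ) (Q : Config Λ N) :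
    List (List (Edge d)) → ℝ
  | [] => 0
  | p :: ps => (dHol e X Q p).trace / N * normProd Q ps + normTrace Q p * dNormProd e X Q ps

theorem continuous_dNormProd (e : Edge d) (X : Matrix (Fin N) (Fin N) ℝ)
    (ps : List (List (Edge d))) : Continuous fun Q : Config Λ N => dNormProd e X Q ps := by
  induction ps with
  | nil => exact continuous_const
  | cons p ps ih =>
    exact (((continuous_dHol e X p).matrix_trace.div_const _).mul (continuous_normProd ps)).add
      ((continuous_normTrace p).mul ih)

/-- Each normalized trace has a derivative of order 1/N, since against a single generator the
holonomy contributes only two bounded entries. This is why mergers disappear in the limit. -/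
theorem abs_dNormProd_le (e : Edge d) (i j : Fin N) (Q : Config Λ N) (ps : List (List (Edge d))) :
    |dNormProd e (rotGen i j) Q ps| ≤ 4 * (ps.map List.length).sum / N := by
  induction ps with
  | nil => simp [dNormProd]
  | cons p ps ih =>
    rw [dNormProd, List.map_cons, List.sum_cons, Nat.cast_add, mul_add, add_div]
    refine (abs_add_le _ _).trans (add_le_add ?_ ?_)
    · rw [abs_mul, abs_div, Nat.abs_cast, ← mul_one (4 * (p.length : ℝ) / N)]
      exact mul_le_mul (div_le_div_of_nonneg_right (abs_trace_dHol_le e i j Q p)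
        (Nat.cast_nonneg _)) (abs_normProd_le Q ps) (abs_nonneg _) (by positivity)
    · rw [abs_mul, ← one_mul (4 * _ / (N : ℝ))]
      exact mul_le_mul (abs_normTrace_le Q p) ih (abs_nonneg _) zero_le_one

theorem hasLieDeriv_pathTrace {e : Edge d} (h1 : e.src ∈ Λ) (h2 : e.tgt ∈ Λ) (i j : Fin N)
    (ρ : List (Edge d)) :
    HasLieDeriv e i j (fun Q : Config Λ N => pathTrace Q ρ)
      (fun Q => (dHol e (rotGen i j) Q ρ).trace) :=
  fun Q => (hasEntryDeriv_hol h1 h2 i j Q ρ).trace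

theorem hasLieDeriv_trace_mul {e : Edge d} (h1 : e.src ∈ Λ) (h2 : e.tgt ∈ Λ) (i j : Fin N)
    (A : Matrix (Fin N) (Fin N) ℝ) (ρ : List (Edge d)) :
    HasLieDeriv e i j (fun Q : Config Λ N => (A * (hol Q ρ).1).trace)
      (fun Q => (A * dHol e (rotGen i j) Q ρ).trace) := by
  intro Q
  have := ((hasEntryDeriv_const A).mul (hasEntryDeriv_hol h1 h2 i j Q ρ)).trace
  rw [zero_mul, zero_add] at this
  exact this

theorem hasLieDeriv_normProd {e : Edge d} (h1 : e.src ∈ Λ) (h2 : e.tgt ∈ Λ) (i j : Fin N)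
    (ps : List (List (Edge d))) :
    HasLieDeriv e i j (fun Q : Config Λ N => normProd Q ps)
      (fun Q => dNormProd e (rotGen i j) Q ps) := by
  induction ps with
  | nil => exact fun Q => hasDerivAt_const _ _
  | cons p ps ih =>
    simp only [normProd_cons]
    exact HasLieDeriv.mul (fun Q => (hasLieDeriv_pathTrace h1 h2 i j p Q).div_const _) ih

/-! ### Integration by parts against the gauge measure -/

/-- The action `Nβ ∑_p W_p`. -/
noncomputable def action (β : ℝ) (Q : Config Λ N) : ℝ :=
  N * β * ∑ p ∈ plaquettesIn Λ, pathTrace Q p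

theorem continuous_action (β : ℝ) : Continuous (action β : Config Λ N → ℝ) :=
  continuous_const.mul (continuous_finsetSum _ fun p _ => continuous_pathTrace p)

theorem integrable_exp_action (β : ℝ) :
    Integrable (fun Q : Config Λ N => Real.exp (action β Q)) (haarConfig Λ N) :=
  integrable_haarConfig (Real.continuous_exp.comp (continuous_action β))

instance (β : ℝ) : IsProbabilityMeasure (gaugeMeasure Λ N β) :=
  isProbabilityMeasure_tilted (μ := haarConfig Λ N) (integrable_exp_action β)

theorem integrable_gaugeMeasure (β : ℝ) {f : Config Λ N → ℝ} (hf : Continuous f) :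
    Integrable f (gaugeMeasure Λ N β) :=
  hf.integrable_of_hasCompactSupport (HasCompactSupport.of_compactSpace f)

theorem integral_gaugeMeasure (β : ℝ) (f : Config Λ N → ℝ) :
    ∫ Q, f Q ∂(gaugeMeasure Λ N β) =
      (∫ Q, Real.exp (action β Q) * f Q ∂(haarConfig Λ N)) /
        ∫ Q, Real.exp (action β Q) ∂(haarConfig Λ N) := by
  unfold gaugeMeasure
  rw [integral_tilted, ← integral_div]
  refine integral_congr_ae (Eventually.of_forall fun Q => ?_)
  simp only [smul_eq_mul]
  unfold action
  ring

/-- The derivative of the action. -/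
noncomputable def dAction (β : ℝ) (e : Edge d) (X : Matrix (Fin N) (Fin N) ℝ)
    (Q : Config Λ N) : ℝ :=
  N * β * ∑ p ∈ plaquettesIn Λ, (dHol e X Q p).trace

theorem continuous_dAction (β : ℝ) (e : Edge d) (X : Matrix (Fin N) (Fin N) ℝ) :
    Continuous (dAction β e X : Config Λ N → ℝ) :=
  continuous_const.mul (continuous_finsetSum _ fun p _ => (continuous_dHol e X p).matrix_trace)

theorem hasLieDeriv_action {e : Edge d} (h1 : e.src ∈ Λ) (h2 : e.tgt ∈ Λ) (i j : Fin N) (β : ℝ) :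
    HasLieDeriv e i j (action β : Config Λ N → ℝ) (dAction β e (rotGen i j)) :=
  fun Q => (HasDerivAt.fun_sum fun p _ => hasLieDeriv_pathTrace h1 h2 i j p Q).const_mul _

/-- The integrand in the integration by parts of `Tr(X W_w) ∏ W_p`, with respect to the gauge
measure, along the rotations in the coordinate plane `i, j`. -/
noncomputable def ibpTerm (β : ℝ) (e : Edge d) (w : List (Edge d)) (ps : List (List (Edge d)))
    (i j : Fin N) (Q : Config Λ N) : ℝ :=
  (rotGen i j * dHol e (rotGen i j) Q w).trace * normProd Q ps +
    (rotGen i j * (hol Q w).1).trace * dNormProd e (rotGen i j) Q ps +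
    (rotGen i j * (hol Q w).1).trace * normProd Q ps * dAction β e (rotGen i j) Q

theorem continuous_ibpTerm (β : ℝ) (e : Edge d) (w : List (Edge d)) (ps : List (List (Edge d)))
    (i j : Fin N) : Continuous (ibpTerm β e w ps i j : Config Λ N → ℝ) := by
  have c1 : Continuous fun Q : Config Λ N => (rotGen i j * (hol Q w).1).trace :=
    (continuous_const.matrix_mul (continuous_hol_val w)).matrix_trace
  have c2 : Continuous fun Q : Config Λ N => (rotGen i j * dHol e (rotGen i j) Q w).trace :=
    (continuous_const.matrix_mul (continuous_dHol e _ w)).matrix_trace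
  exact ((c2.mul (continuous_normProd ps)).add (c1.mul (continuous_dNormProd e _ ps))).add
    ((c1.mul (continuous_normProd ps)).mul (continuous_dAction β e _))

theorem integral_ibpTerm {e : Edge d} (h1 : e.src ∈ Λ) (h2 : e.tgt ∈ Λ) (β : ℝ)
    (w : List (Edge d)) (ps : List (List (Edge d))) (i j : Fin N) :
    ∫ Q, ibpTerm β e w ps i j Q ∂(gaugeMeasure Λ N β) = 0 := by
  rw [integral_gaugeMeasure]
  have c1 : Continuous fun Q : Config Λ N => (rotGen i j * (hol Q w).1).trace :=
    (continuous_const.matrix_mul (continuous_hol_val w)).matrix_trace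
  have he : HasLieDeriv e i j (fun Q : Config Λ N => Real.exp (action β Q))
      (fun Q => Real.exp (action β Q) * dAction β e (rotGen i j) Q) := by
    intro Q
    have := (hasLieDeriv_action h1 h2 i j β Q).exp
    simp only [act_rotSO_zero] at this
    exact this
  have h := ((hasLieDeriv_trace_mul h1 h2 i j (rotGen i j) w).mul
    (hasLieDeriv_normProd h1 h2 i j ps)).mul he
  have hce : Continuous fun Q : Config Λ N => Real.exp (action β Q) :=
    Real.continuous_exp.comp (continuous_action β)
  have heq : ∀ Q : Config Λ N, Real.exp (action β Q) * ibpTerm β e w ps i j Q =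
      ((rotGen i j * dHol e (rotGen i j) Q w).trace * normProd Q ps +
        (rotGen i j * (hol Q w).1).trace * dNormProd e (rotGen i j) Q ps) *
          Real.exp (action β Q) +
      (rotGen i j * (hol Q w).1).trace * normProd Q ps *
        (Real.exp (action β Q) * dAction β e (rotGen i j) Q) := by
    intro Q
    unfold ibpTerm
    ring
  have h0 := h.integral_eq_zero ((c1.mul (continuous_normProd ps)).mul hce) (by
    refine Continuous.congr ?_ heq
    exact hce.mul (continuous_ibpTerm β e w ps i j))
  simp only [heq]
  rw [h0, zero_div]

/-- The leading terms of the Schwinger-Dyson equation for the word `eτ` at its first location. -/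
noncomputable def sdTerm (β : ℝ) (Q : Config Λ N) (e : Edge d) (τ : List (Edge d)) : ℝ :=
  -normTrace Q (e :: τ)
    - (∑ y ∈ locs τ e, normTrace Q (e :: τ.take y) * normTrace Q (τ.drop y))
    + (∑ y ∈ locs τ e.inv, normTrace Q (τ.take y) * normTrace Q (τ.drop (y + 1)))
    + β * ∑ p ∈ plaquettesIn Λ, plaqTerm Q e (e :: τ) p / N

theorem pathTrace_cons_take_succ (Q : Config Λ N) {e : Edge d} {τ : List (Edge d)} {y : ℕ}
    (h : y ∈ locs τ e.inv) : pathTrace Q (e :: τ.take (y + 1)) = pathTrace Q (τ.take y) := by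
  rw [mem_locs] at h
  rw [List.take_add_one, h, Option.toList_some, ← List.cons_append, pathTrace_append_comm]
  simp [pathTrace_eq, edgeVar_inv]

/-- Summed over all planes, the leading terms have order N²: products of two traces from the word,
and the derivative of the action with its prefactor N. Single traces from the word (twistings) and
derivatives of the other loops (mergers) are only of order N. -/
theorem abs_sum_ibpTerm_sub_le (hN : 0 < N) (β : ℝ) (e : Edge d) (τ : List (Edge d))
    (ps : List (List (Edge d))) (Q : Config Λ N) :
    |(∑ i, ∑ j, ibpTerm β e (e :: τ) ps i j Q) - 2 * N ^ 2 * (sdTerm β Q e τ * normProd Q ps)| ≤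
      2 * N * (2 * ((τ.length : ℝ) + 1) + 4 * ((ps.map List.length).sum : ℝ)) := by
  have hN' : (N : ℝ) ≠ 0 := Nat.cast_ne_zero.mpr hN.ne'
  have hS : ∑ i, ∑ j, ibpTerm β e (e :: τ) ps i j Q =
      (∑ i, ∑ j, (rotGen i j * dHol e (rotGen i j) Q (e :: τ)).trace) * normProd Q ps +
      (∑ i, ∑ j, (rotGen i j * (hol Q (e :: τ)).1).trace * dNormProd e (rotGen i j) Q ps) +
      normProd Q ps * (N * β * ∑ p ∈ plaquettesIn Λ, ∑ i, ∑ j,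
        (rotGen i j * (hol Q (e :: τ)).1).trace * (dHol e (rotGen i j) Q p).trace) := by
    simp only [ibpTerm, dAction, Finset.sum_add_distrib, Finset.sum_mul]
    congr 1
    simp only [Finset.sum_comm (s := plaquettesIn Λ), Finset.mul_sum]
    exact Finset.sum_congr rfl fun i _ => Finset.sum_congr rfl fun j _ =>
      Finset.sum_congr rfl fun p _ => by ring
  set w := e :: τ with hw
  -- `T1` and `T2` collect the twistings: a bounded number of single traces, each at most N in
  -- absolute value.
  set T1 := ∑ y ∈ locs w e, ((hol Q (w.take y))⁻¹ * hol Q (w.drop y) : SO N).1.trace with hT1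
  set T2 := ∑ y ∈ locs w e.inv,
    ((hol Q (w.take (y + 1)))⁻¹ * hol Q (w.drop (y + 1)) : SO N).1.trace with hT2
  have hlen : (w.length : ℝ) = τ.length + 1 := by simp [hw]
  have hb1 : |T1| ≤ w.length * N := abs_sum_locs_le (Nat.cast_nonneg _) _ _ _
    fun y => SO.abs_trace_le _
  have hb2 : |T2| ≤ w.length * N := abs_sum_locs_le (Nat.cast_nonneg _) _ _ _
    fun y => SO.abs_trace_le _
  have hb3 : |∑ i, ∑ j, (rotGen i j * (hol Q w).1).trace * dNormProd e (rotGen i j) Q ps| ≤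
      8 * N * (ps.map List.length).sum := by
    have h : ∀ i j : Fin N, |(rotGen i j * (hol Q w).1).trace * dNormProd e (rotGen i j) Q ps| ≤
        2 * (4 * (ps.map List.length).sum / N) := by
      intro i j
      rw [abs_mul]
      exact mul_le_mul (abs_trace_rotGen_mul_le i j _) (abs_dNormProd_le e i j Q ps)
        (abs_nonneg _) zero_le_two
    have h' : ∀ i : Fin N, |∑ j, (rotGen i j * (hol Q w).1).trace *
        dNormProd e (rotGen i j) Q ps| ≤ N * (2 * (4 * (ps.map List.length).sum / N)) := by
      intro i
      refine (Finset.abs_sum_le_sum_abs _ _).trans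
        ((Finset.sum_le_card_nsmul _ _ _ fun j _ => h i j).trans (le_of_eq ?_))
      simp
    refine (Finset.abs_sum_le_sum_abs _ _).trans
      ((Finset.sum_le_card_nsmul _ _ _ fun i _ => h' i).trans (le_of_eq ?_))
    simp only [Finset.card_univ, Fintype.card_fin, nsmul_eq_mul]
    field_simp
    ring
  -- At the first location of the word the cut leaves an empty piece with trace N. That term becomes
  -- the summand −φ(s) of this location; the other locations of e are genuine splittings.
  have hA : ∑ y ∈ locs w e, pathTrace Q (w.take y) * pathTrace Q (w.drop y) =
      N ^ 2 * (normTrace Q w +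
        ∑ y ∈ locs τ e, normTrace Q (e :: τ.take y) * normTrace Q (τ.drop y)) := by
    have h1 : ∀ y, 1 + y = y + 1 := Nat.add_comm 1
    rw [hw, sum_locs_cons, if_pos rfl, mul_add, Finset.mul_sum]
    simp only [h1, List.take_zero, List.drop_zero, List.take_succ_cons, List.drop_succ_cons,
      normTrace]
    congr 1
    · simp only [pathTrace_eq, hol_nil]
      rw [show ((1 : SO N).1).trace = (N : ℝ) by
        change (1 : Matrix (Fin N) (Fin N) ℝ).trace = N; simp]
      field_simp
    · exact Finset.sum_congr rfl fun y _ => by field_simp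
  -- The initial e cancels the e⁻¹ at the cut, which gives the negative splitting.
  have hB : ∑ y ∈ locs w e.inv, pathTrace Q (w.take (y + 1)) * pathTrace Q (w.drop (y + 1)) =
      N ^ 2 * ∑ y ∈ locs τ e.inv, normTrace Q (τ.take y) * normTrace Q (τ.drop (y + 1)) := by
    have h1 : ∀ y, 1 + y = y + 1 := Nat.add_comm 1
    rw [hw, sum_locs_cons, if_neg e.ne_inv, zero_add, Finset.mul_sum]
    simp only [h1, List.take_succ_cons, List.drop_succ_cons, normTrace]
    refine Finset.sum_congr rfl fun y hy => ?_
    rw [pathTrace_cons_take_succ Q hy]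
    field_simp
  have hmain : (∑ i, ∑ j, ibpTerm β e w ps i j Q) -
      2 * N ^ 2 * (sdTerm β Q e τ * normProd Q ps) =
      2 * (T1 - T2) * normProd Q ps +
      ∑ i, ∑ j, (rotGen i j * (hol Q w).1).trace * dNormProd e (rotGen i j) Q ps := by
    rw [hS, sum_trace_rotGen_mul_dHol]
    simp only [sum_trace_rotGen_mul_trace_dHol, Finset.sum_sub_distrib, ← Finset.mul_sum]
    rw [← hT1, ← hT2, hA, hB, sdTerm, ← hw, ← Finset.sum_div]
    field_simp
    ring
  rw [hmain]
  have hb4 : |2 * (T1 - T2) * normProd Q ps| ≤ 2 * (w.length * N + w.length * N) := by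
    rw [abs_mul, abs_mul, abs_two]
    have := abs_sub T1 T2
    calc _ ≤ 2 * |T1 - T2| * 1 := by
          gcongr
          exact abs_normProd_le Q ps
      _ ≤ _ := by linarith
  refine (abs_add_le _ _).trans ((add_le_add hb4 hb3).trans (le_of_eq ?_))
  rw [hlen]
  ring

theorem continuous_plaqTerm (e : Edge d) (w p : List (Edge d)) :
    Continuous fun Q : Config Λ N => plaqTerm Q e w p := by
  unfold plaqTerm
  have := fun ρ => continuous_pathTrace (Λ := Λ) (N := N) ρ
  fun_prop

theorem continuous_sdTerm (β : ℝ) (e : Edge d) (τ : List (Edge d)) :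
    Continuous fun Q : Config Λ N => sdTerm β Q e τ := by
  unfold sdTerm
  have h1 := fun ρ => continuous_normTrace (Λ := Λ) (N := N) ρ
  have h2 := fun w p => continuous_plaqTerm (Λ := Λ) (N := N) e w p
  fun_prop

/-- The Schwinger-Dyson equation for the word `eτ` at its first location, up to an error of
order `1/N`. -/
theorem abs_integral_sdTerm_le (hN : 0 < N) {e : Edge d} (h1 : e.src ∈ Λ) (h2 : e.tgt ∈ Λ)
    (β : ℝ) (τ : List (Edge d)) (ps : List (List (Edge d))) :
    |∫ Q, sdTerm β Q e τ * normProd Q ps ∂(gaugeMeasure Λ N β)| ≤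
      (2 * ((τ.length : ℝ) + 1) + 4 * ((ps.map List.length).sum : ℝ)) / N := by
  have hN' : (0 : ℝ) < N := Nat.cast_pos.mpr hN
  have hI : ∫ Q, ∑ i, ∑ j, ibpTerm β e (e :: τ) ps i j Q ∂(gaugeMeasure Λ N β) = 0 := by
    rw [integral_finsetSum _ fun i _ => integrable_gaugeMeasure β
      (continuous_finsetSum _ fun j _ => continuous_ibpTerm β e _ ps i j)]
    refine Finset.sum_eq_zero fun i _ => ?_
    rw [integral_finsetSum _ fun j _ => integrable_gaugeMeasure β
      (continuous_ibpTerm β e _ ps i j)]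
    exact Finset.sum_eq_zero fun j _ => integral_ibpTerm h1 h2 β _ ps i j
  have hc1 : Continuous fun Q : Config Λ N => ∑ i, ∑ j, ibpTerm β e (e :: τ) ps i j Q :=
    continuous_finsetSum _ fun i _ => continuous_finsetSum _ fun j _ =>
      continuous_ibpTerm β e _ ps i j
  have hc2 : Continuous fun Q : Config Λ N => sdTerm β Q e τ * normProd Q ps :=
    (continuous_sdTerm β e τ).mul (continuous_normProd ps)
  have hb : ∀ Q : Config Λ N, ‖(∑ i, ∑ j, ibpTerm β e (e :: τ) ps i j Q) -
      2 * N ^ 2 * (sdTerm β Q e τ * normProd Q ps)‖ ≤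
      2 * N * (2 * ((τ.length : ℝ) + 1) + 4 * ((ps.map List.length).sum : ℝ)) :=
    fun Q => abs_sum_ibpTerm_sub_le hN β e τ ps Q
  have h := norm_integral_le_of_norm_le_const (μ := gaugeMeasure Λ N β)
    (Eventually.of_forall hb)
  rw [integral_sub (integrable_gaugeMeasure β hc1)
    (integrable_gaugeMeasure β (hc2.const_mul _)), hI, zero_sub, norm_neg,
    integral_const_mul, probReal_univ, mul_one, Real.norm_eq_abs, abs_mul,
    abs_of_pos (by positivity : (0 : ℝ) < 2 * N ^ 2)] at h
  rw [le_div_iff₀ hN']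
  refine le_of_mul_le_mul_left (a := 2 * (N : ℝ)) (le_trans (le_of_eq ?_) h) (by positivity)
  ring

/-! ### Wilson loop variables of the operations on loops -/

theorem pathTrace_eq_of_conj {Q : Config Λ N} {ρ ρ' : List (Edge d)} (g : SO N)
    (h : hol Q ρ' = g * hol Q ρ * g⁻¹) : pathTrace Q ρ' = pathTrace Q ρ := by
  rw [pathTrace_eq, pathTrace_eq, h]
  change ((g.1 * (hol Q ρ).1) * (g⁻¹ : SO N).1).trace = _
  rw [Matrix.trace_mul_comm, ← mul_assoc]
  change ((g⁻¹ * g : SO N).1 * (hol Q ρ).1).trace = _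
  rw [inv_mul_cancel]
  change (1 * (hol Q ρ).1).trace = _
  rw [one_mul]

theorem eq_before_between_after {ρ : List (Edge d)} {e f : Edge d} {x y : ℕ} (hxy : x < y)
    (hx : ρ[x]? = some e) (hy : ρ[y]? = some f) :
    ρ = before ρ x ++ e :: (between ρ x y ++ f :: after ρ y) := by
  have h1 := eq_before_append hy
  have h2 : (before ρ y)[x]? = some e := by
    rw [before, List.getElem?_take_of_lt hxy, hx]
  have h3 := eq_before_append h2
  have h4 : before (before ρ y) x = before ρ x := by
    simp [before, List.take_take, hxy.le]
  have h5 : after (before ρ y) x = between ρ x y := rfl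
  rw [h4, h5] at h3
  conv_lhs => rw [h1, h3]
  simp

theorem drop_eq_cons_after {ρ : List (Edge d)} {e : Edge d} {x : ℕ} (h : ρ[x]? = some e) :
    ρ.drop x = e :: after ρ x := by
  obtain ⟨h1, h2⟩ := List.getElem?_eq_some_iff.mp h
  rw [List.drop_eq_getElem_cons h1, h2]
  rfl

theorem posSplit_swap {ρ : List (Edge d)} (e : Edge d) {x y : ℕ} (hxy : x < y) :
    posSplit ρ e y x = ((posSplit ρ e x y).2, (posSplit ρ e x y).1) := by
  simp [posSplit, hxy, hxy.le]

theorem negSplit_swap {ρ : List (Edge d)} {x y : ℕ} (hxy : x < y) :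
    negSplit ρ y x = ((negSplit ρ x y).2, (negSplit ρ x y).1) := by
  simp [negSplit, hxy, hxy.le]

theorem wilson_posSplit {ρ : List (Edge d)} (hρ : IsClosedPath ρ) {e : Edge d} {x y : ℕ}
    (hxy : x < y) (hx : ρ[x]? = some e) (hy : ρ[y]? = some e) (Q : Config Λ N) :
    wilson Q (posSplit ρ e x y).1 = pathTrace Q (e :: after ρ y ++ before ρ x) ∧
      wilson Q (posSplit ρ e x y).2 = pathTrace Q (e :: between ρ x y) := by
  obtain ⟨u, hw⟩ := isClosedPath_iff.mp hρ
  rw [eq_before_between_after hxy hx hy] at hw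
  simp only [walk_append, walk_cons] at hw
  obtain ⟨_, ha, rfl, _, hb, rfl, hc⟩ := hw
  simp only [posSplit, if_pos hxy]
  constructor
  · rw [wilson_core (isClosedPath_iff.mpr ⟨u, ?_⟩), pathTrace_append_comm]
    rw [walk_append]
    exact ⟨_, ha, rfl, hc⟩
  · rw [wilson_core (isClosedPath_iff.mpr ⟨e.tgt, ?_⟩), pathTrace_append_comm]
    · rfl
    · rw [walk_append]
      exact ⟨_, hb, rfl, rfl⟩

theorem wilson_negSplit {ρ : List (Edge d)} (hρ : IsClosedPath ρ) {e f : Edge d} {x y : ℕ}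
    (hxy : x < y) (hx : ρ[x]? = some e) (hy : ρ[y]? = some f) (hf : f = e.inv)
    (Q : Config Λ N) :
    wilson Q (negSplit ρ x y).1 = pathTrace Q (after ρ y ++ before ρ x) ∧
      wilson Q (negSplit ρ x y).2 = pathTrace Q (between ρ x y) := by
  obtain ⟨u, hw⟩ := isClosedPath_iff.mp hρ
  rw [eq_before_between_after hxy hx hy, hf] at hw
  simp only [walk_append, walk_cons, Edge.inv_src, Edge.inv_tgt] at hw
  obtain ⟨_, ha, rfl, _, hb, rfl, hc⟩ := hw
  simp only [negSplit, if_pos hxy]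
  constructor
  · rw [wilson_core (isClosedPath_iff.mpr ⟨u, ?_⟩), pathTrace_append_comm]
    rw [walk_append]
    exact ⟨_, ha, hc⟩
  · exact wilson_core (isClosedPath_iff.mpr ⟨e.tgt, hb⟩) Q

/-- A plaquette meets e or e⁻¹ at exactly one location, so the derivative of its trace has one term.
When it contains e⁻¹ the sign of that term flips, and the two joined words exchange their roles as
positive and negative deformations. Each word agrees with the corresponding deformed loop up to
conjugation by the part of ρ from location x to its end. -/
theorem plaqTerm_eq {ρ p : List (Edge d)} (hρ : IsClosedPath ρ) {e : Edge d} {x : ℕ}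
    (hx : ρ[x]? = some e) (hp : p ∈ plaquettesAt e) (Q : Config Λ N) :
    plaqTerm Q e (e :: (after ρ x ++ before ρ x)) p =
      wilson Q (negDeform ρ e x p) - wilson Q (posDeform ρ e x p) := by
  obtain ⟨hp1, hp2⟩ := mem_plaquettesAt.mp hp
  obtain ⟨u, hw⟩ := isClosedPath_iff.mp hρ
  rw [eq_before_append hx] at hw
  simp only [walk_append, walk_cons] at hw
  obtain ⟨_, ha, rfl, hc⟩ := hw
  unfold plaqTerm negDeform posDeform negMerge posMerge
  rcases getElem?_locIn hp2 with hk | hk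
  · obtain ⟨hl1, hl2⟩ := locs_locIn hp1 (Or.inl rfl) hk
    obtain ⟨v, hv⟩ := isClosedPath_iff.mp hp1.1
    have hpe := eq_before_append hk
    rw [hpe] at hv
    simp only [walk_append, walk_cons] at hv
    obtain ⟨_, hB, rfl, hA⟩ := hv
    have hdrop := drop_eq_cons_after hk
    have htake : p.take (locIn p e) = before p (locIn p e) := rfl
    rw [hl1, hl2, Finset.sum_singleton, Finset.sum_empty, sub_zero, if_pos hk, if_pos hk, hdrop,
      htake]
    congr 1
    · rw [wilson_core (isClosedPath_iff.mpr ⟨u, ?_⟩)]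
      · refine pathTrace_eq_of_conj (edgeVar Q e * hol Q (after ρ x)) ?_
        simp [mul_assoc]
      · simp only [walk_append]
        exact ⟨_, ⟨_, ⟨_, ha, hB.invPath⟩, hA.invPath⟩, hc⟩
    · rw [wilson_core (isClosedPath_iff.mpr ⟨u, ?_⟩)]
      · refine pathTrace_eq_of_conj (edgeVar Q e * hol Q (after ρ x)) ?_
        simp [mul_assoc]
      · simp only [walk_append, walk_cons, walk_nil]
        exact ⟨_, ⟨_, ⟨_, ⟨_, ⟨_, ha, rfl, rfl⟩, hA⟩, hB⟩, rfl, rfl⟩, hc⟩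
  · obtain ⟨hl1, hl2⟩ := locs_locIn hp1 (Or.inr rfl) hk
    rw [Edge.inv_inv] at hl2
    have hk' : ¬ p[locIn p e]? = some e := by
      rw [hk]
      exact fun h => e.inv_ne (Option.some.inj h)
    obtain ⟨v, hv⟩ := isClosedPath_iff.mp hp1.1
    have hpe := eq_before_append hk
    rw [hpe] at hv
    simp only [walk_append, walk_cons, Edge.inv_src, Edge.inv_tgt] at hv
    obtain ⟨_, hB, rfl, hA⟩ := hv
    have hdrop : p.drop (locIn p e + 1) = after p (locIn p e) := rfl
    have htake : p.take (locIn p e + 1) = before p (locIn p e) ++ [e.inv] := by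
      rw [List.take_add_one, hk]; rfl
    rw [hl1, hl2, Finset.sum_singleton, Finset.sum_empty, zero_sub, neg_sub, if_neg hk',
      if_neg hk', hdrop, htake]
    congr 1
    · rw [wilson_core (isClosedPath_iff.mpr ⟨u, ?_⟩)]
      · refine pathTrace_eq_of_conj (edgeVar Q e * hol Q (after ρ x)) ?_
        simp [mul_assoc, edgeVar_inv]
      · simp only [walk_append]
        exact ⟨_, ⟨_, ⟨_, ha, hA⟩, hB⟩, hc⟩
    · rw [wilson_core (isClosedPath_iff.mpr ⟨u, ?_⟩)]
      · refine pathTrace_eq_of_conj (edgeVar Q e * hol Q (after ρ x)) ?_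
        simp [mul_assoc, edgeVar_inv]
      · simp only [walk_append, walk_cons, walk_nil]
        exact ⟨_, ⟨_, ⟨_, ⟨_, ⟨_, ha, rfl, rfl⟩, hB.invPath⟩, hA.invPath⟩, rfl, rfl⟩, hc⟩

theorem plaqTerm_eq_zero {p w : List (Edge d)} {e : Edge d} (h : e ∉ p) (h' : e.inv ∉ p)
    (Q : Config Λ N) : plaqTerm Q e w p = 0 := by
  simp [plaqTerm, locs_eq_empty h, locs_eq_empty h']

/-- The normalized Wilson loop variable. -/
noncomputable def normWilson (Q : Config Λ N) (l : Loop d) : ℝ := wilson Q l / N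

/-- Rotating ρ to begin at x turns cuts of the word into splittings at x and y. The condition on Λ
ensures that no plaquette at e is missing from the action; the plaquettes away from e contribute
zero. -/
theorem sdTerm_eq {ρ : List (Edge d)} (hρ : IsClosedPath ρ) {e : Edge d} {x : ℕ}
    (hx : ρ[x]? = some e) (hΛ : plaquettesAt e ⊆ plaquettesIn Λ) (β : ℝ) (Q : Config Λ N) :
    sdTerm β Q e (after ρ x ++ before ρ x) =
      -normTrace Q ρ
      - (∑ y ∈ (locs ρ e).erase x,
          normWilson Q (posSplit ρ e x y).1 * normWilson Q (posSplit ρ e x y).2)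
      + (∑ y ∈ locs ρ e.inv, normWilson Q (negSplit ρ x y).1 * normWilson Q (negSplit ρ x y).2)
      + β * ∑ p ∈ plaquettesAt e,
          (normWilson Q (negDeform ρ e x p) - normWilson Q (posDeform ρ e x p)) := by
  have hlt : x < ρ.length := (List.getElem?_eq_some_iff.mp hx).1
  have hlb : (before ρ x).length = x := length_before hlt
  have hcons : ∀ {a b : List (Edge d)} {f : Edge d} {y : ℕ}, y ∈ locs a f →
      (a ++ b).drop y = f :: (after a y ++ b) ∧ (a ++ b).drop (y + 1) = after a y ++ b ∧
        (a ++ b).take y = before a y := by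
    intro a b f y hy
    have hy' := mem_locs.mp hy
    have hl : y < a.length := (List.getElem?_eq_some_iff.mp hy').1
    refine ⟨?_, ?_, ?_⟩
    · rw [List.drop_append_of_le_length hl.le, drop_eq_cons_after hy', List.cons_append]
    · rw [List.drop_append_of_le_length hl]; rfl
    · rw [List.take_append_of_le_length hl.le]; rfl
  have hbefore : ∀ {y : ℕ} {f : Edge d}, y ∈ locs (before ρ x) f → y < x ∧ ρ[y]? = some f ∧
      (before ρ x).take y = before ρ y := by
    intro y f hy
    have hy' := mem_locs.mp hy
    have hl : y < x := hlb ▸ (List.getElem?_eq_some_iff.mp hy').1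
    refine ⟨hl, ?_, ?_⟩
    · rwa [before, List.getElem?_take_of_lt hl] at hy'
    · simp [before, List.take_take, hl.le]
  have hafter : ∀ {y : ℕ} {f : Edge d}, y ∈ locs (after ρ x) f → ρ[x + 1 + y]? = some f ∧
      before (after ρ x) y = between ρ x (x + 1 + y) ∧
      after (after ρ x) y = after ρ (x + 1 + y) := by
    intro y f hy
    have hy' := mem_locs.mp hy
    refine ⟨?_, ?_, ?_⟩
    · rwa [after, List.getElem?_drop] at hy'
    · simp only [before, after, between, List.take_drop]
    · simp only [after, List.drop_drop, add_assoc]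
  have hempty : ∀ {b : List (Edge d)} (k : ℕ), (after ρ x ++ b).take ((after ρ x).length + k) =
      after ρ x ++ b.take k ∧ (after ρ x ++ b).drop ((after ρ x).length + k) = b.drop k :=
    fun k => ⟨List.take_length_add_append k, List.drop_length_add_append k⟩
  unfold sdTerm
  have e1 : normTrace Q (e :: (after ρ x ++ before ρ x)) = normTrace Q ρ := by
    conv_rhs => rw [eq_before_append hx]
    rw [normTrace, normTrace, ← List.cons_append, pathTrace_append_comm]
  have e2 : ∑ y ∈ locs (after ρ x ++ before ρ x) e,
      normTrace Q (e :: (after ρ x ++ before ρ x).take y) *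
        normTrace Q ((after ρ x ++ before ρ x).drop y) =
      ∑ y ∈ (locs ρ e).erase x,
        normWilson Q (posSplit ρ e x y).1 * normWilson Q (posSplit ρ e x y).2 := by
    rw [sum_locs_append, sum_locs_erase hx, add_comm]
    congr 1
    -- Locations before x come after it in the rotated word. Here y < x, so the two loops appear in
    -- the swapped order.
    · refine Finset.sum_congr rfl fun y hy => ?_
      obtain ⟨hyx, hy1, hy2⟩ := hbefore hy
      obtain ⟨w1, w2⟩ := wilson_posSplit hρ hyx hy1 hx Q
      have h3 := (hcons (b := []) hy).1
      rw [List.append_nil, List.append_nil] at h3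
      rw [posSplit_swap e hyx, normWilson, normWilson, w1, w2, (hempty y).1, (hempty y).2, h3,
        hy2, mul_comm]
      rfl
    · refine Finset.sum_congr rfl fun y hy => ?_
      obtain ⟨hy1, hy2, hy3⟩ := hafter hy
      obtain ⟨w1, w2⟩ := wilson_posSplit hρ (by omega : x < x + 1 + y) hx hy1 Q
      obtain ⟨c1, c2, c3⟩ := hcons (b := before ρ x) hy
      rw [normWilson, normWilson, w1, w2, c1, c3, hy2, hy3, mul_comm]
      rfl
  have e3 : ∑ y ∈ locs (after ρ x ++ before ρ x) e.inv,
      normTrace Q ((after ρ x ++ before ρ x).take y) *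
        normTrace Q ((after ρ x ++ before ρ x).drop (y + 1)) =
      ∑ y ∈ locs ρ e.inv,
        normWilson Q (negSplit ρ x y).1 * normWilson Q (negSplit ρ x y).2 := by
    have hne : x ∉ locs ρ e.inv := by
      rw [mem_locs, hx]
      exact fun h => e.ne_inv (Option.some.inj h)
    rw [← Finset.erase_eq_of_notMem hne, sum_locs_append, sum_locs_erase hx, add_comm]
    congr 1
    · refine Finset.sum_congr rfl fun y hy => ?_
      obtain ⟨hyx, hy1, hy2⟩ := hbefore hy
      obtain ⟨w1, w2⟩ := wilson_negSplit hρ hyx hy1 hx (e.inv_inv.symm) Q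
      have h3 := (hcons (b := []) hy).2.1
      rw [List.append_nil, List.append_nil] at h3
      rw [negSplit_swap hyx, normWilson, normWilson, w1, w2, (hempty y).1, add_assoc,
        (hempty (y + 1)).2, h3, hy2, mul_comm]
      rfl
    · refine Finset.sum_congr rfl fun y hy => ?_
      obtain ⟨hy1, hy2, hy3⟩ := hafter hy
      obtain ⟨w1, w2⟩ := wilson_negSplit hρ (by omega : x < x + 1 + y) hx hy1 rfl Q
      obtain ⟨c1, c2, c3⟩ := hcons (b := before ρ x) hy
      rw [normWilson, normWilson, w1, w2, c2, c3, hy2, hy3, mul_comm]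
      rfl
  have e4 : ∑ p ∈ plaquettesIn Λ, plaqTerm Q e (e :: (after ρ x ++ before ρ x)) p / N =
      ∑ p ∈ plaquettesAt e,
        (normWilson Q (negDeform ρ e x p) - normWilson Q (posDeform ρ e x p)) := by
    rw [← Finset.sum_subset hΛ]
    · refine Finset.sum_congr rfl fun p hp => ?_
      rw [plaqTerm_eq hρ hx hp, sub_div]
      rfl
    · intro p hp hp'
      rw [mem_plaquettesAt, not_and, not_or] at hp'
      obtain ⟨h1, h2⟩ := hp' (mem_plaquettesIn.mp hp).1
      rw [plaqTerm_eq_zero h1 h2, zero_div]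
  rw [e1, e2, e3, e4]

/-! ### Expectations -/

/-- A null loop has normalized trace N/N = 1, so the expectation may be computed from any
representative. -/
theorem wilsonPhi_mk (hN : 0 < N) (β : ℝ) (ls : List (Loop d)) :
    wilsonPhi Λ N β (.mk ls) =
      ∫ Q, (ls.map (normWilson Q)).prod ∂(gaugeMeasure Λ N β) := by
  have hN' : (N : ℝ) ≠ 0 := Nat.cast_ne_zero.mpr hN.ne'
  have h : ∀ (Q : Config Λ N) (s : List (Loop d)),
      (s.map (normWilson Q)).prod = (s.map (wilson Q)).prod / (N : ℝ) ^ s.length := by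
    intro Q s
    induction s with
    | nil => simp
    | cons l s ih =>
      rw [List.map_cons, List.prod_cons, ih, List.map_cons, List.prod_cons, List.length_cons,
        pow_succ', mul_div_mul_comm]
      rfl
  rw [wilsonPhi, LoopSeq.minRep_mk, ← integral_div]
  refine integral_congr_ae (Eventually.of_forall fun Q => ?_)
  simp only [← h]
  refine prod_map_dropNull ?_ ls
  rw [normWilson, wilson_null, div_self hN']

/-- Paths that represent the given loops. -/
noncomputable def reps (ls : List (Loop d)) : List (List (Edge d)) :=
  ls.map fun l => Quotient.out l.1

theorem prod_map_normWilson (Q : Config Λ N) (ls : List (Loop d)) :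
    (ls.map (normWilson Q)).prod = normProd Q (reps ls) := by
  rw [normProd, reps, List.map_map]
  congr 1
  refine List.map_congr_left fun l _ => ?_
  rw [normWilson, wilson_eq (ρ := Quotient.out l.1) (Quotient.out_eq _)]
  rfl

theorem continuous_normWilson (l : Loop d) :
    Continuous fun Q : Config Λ N => normWilson Q l := by
  obtain ⟨ρ, hρ⟩ := exists_list l
  have : (fun Q : Config Λ N => normWilson Q l) = fun Q => normTrace Q ρ := by
    funext Q
    rw [normWilson, wilson_eq hρ]
    rfl
  rw [this]
  exact continuous_normTrace ρ

theorem abs_wilsonPhi_le_one (hN : 0 < N) (β : ℝ) (s : LoopSeq d) : |wilsonPhi Λ N β s| ≤ 1 := by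
  rw [← LoopSeq.mk_minRep s, wilsonPhi_mk hN]
  simp only [prod_map_normWilson]
  have hb : ∀ Q : Config Λ N, ‖normProd Q (reps s.minRep)‖ ≤ 1 := fun Q => abs_normProd_le Q _
  have h := norm_integral_le_of_norm_le_const (μ := gaugeMeasure Λ N β)
    (Eventually.of_forall hb)
  rwa [probReal_univ, mul_one] at h

theorem wilsonPhi_null (hN : 0 < N) (β : ℝ) : wilsonPhi Λ N β LoopSeq.null = 1 := by
  rw [← LoopSeq.mk_minRep LoopSeq.null, wilsonPhi_mk hN, LoopSeq.minRep_null]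
  simp

/-! ### The contribution of one location to the master loop equation -/

/-- The contribution of the location `x`, with edge `e`, to the master loop equation for
`(l₁, ls)`, where `ρ` is a path that represents `l₁`. -/
noncomputable def locTerm (β : ℝ) (φ : LoopSeq d → ℝ) (l₁ : Loop d) (ρ : List (Edge d))
    (e : Edge d) (ls : List (Loop d)) (x : ℕ) : ℝ :=
  -φ (.mk (l₁ :: ls))
    - (∑ y ∈ (locs ρ e).erase x, φ (.mk ((posSplit ρ e x y).1 :: (posSplit ρ e x y).2 :: ls)))
    + (∑ y ∈ locs ρ e.inv, φ (.mk ((negSplit ρ x y).1 :: (negSplit ρ x y).2 :: ls)))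
    + β * ∑ p ∈ plaquettesAt e,
        (φ (.mk (negDeform ρ e x p :: ls)) - φ (.mk (posDeform ρ e x p :: ls)))

/-- Locations in B are handled with e⁻¹ as the distinguished edge, which exchanges A and B. The
summands −φ(s) add up to −mφ(s). -/
theorem sum_locTerm (β : ℝ) (φ : LoopSeq d → ℝ) (l₁ : Loop d) (ρ : List (Edge d))
    (e : Edge d) (ls : List (Loop d)) :
    ∑ x ∈ locs ρ e, locTerm β φ l₁ ρ e ls x + ∑ x ∈ locs ρ e.inv, locTerm β φ l₁ ρ e.inv ls x =
      splittingTerm φ ρ e ls + deformationTerm β φ ρ e ls -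
        ((locs ρ e ∪ locs ρ e.inv).card : ℝ) * φ (.mk (l₁ :: ls)) := by
  rw [Finset.card_union_of_disjoint (disjoint_locs_inv ρ e), Nat.cast_add]
  simp only [locTerm, splittingTerm, deformationTerm, Finset.sum_add_distrib,
    Finset.sum_sub_distrib, Edge.inv_inv, plaquettesAt_inv, Finset.sum_const, nsmul_eq_mul,
    ← Finset.mul_sum]
  simp only [Finset.sum_comm (t := plaquettesAt e)]
  ring

theorem locTerm_wilsonPhi (hN : 0 < N) {l₁ : Loop d} {ρ : List (Edge d)}
    (hl : (ρ : Cycle (Edge d)) = l₁.1) {e : Edge d} {x : ℕ} (hx : ρ[x]? = some e)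
    (hΛ : plaquettesAt e ⊆ plaquettesIn Λ) (β : ℝ) (ls : List (Loop d)) :
    locTerm β (wilsonPhi Λ N β) l₁ ρ e ls x =
      ∫ Q, sdTerm β Q e (after ρ x ++ before ρ x) * normProd Q (reps ls)
        ∂(gaugeMeasure Λ N β) := by
  have hρ := Loop.isClosedPath hl
  have c := fun l => continuous_normWilson (Λ := Λ) (N := N) (l : Loop d)
  have cP := continuous_normProd (Λ := Λ) (N := N) (reps ls)
  have i1 : ∀ l : Loop d, Integrable (fun Q => normWilson Q l * normProd Q (reps ls))
      (gaugeMeasure Λ N β) := fun l => integrable_gaugeMeasure β ((c l).mul cP)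
  have i2 : ∀ l l' : Loop d,
      Integrable (fun Q => normWilson Q l * normWilson Q l' * normProd Q (reps ls))
      (gaugeMeasure Λ N β) := fun l l' => integrable_gaugeMeasure β (((c l).mul (c l')).mul cP)
  have f1 : ∀ l : Loop d, wilsonPhi Λ N β (.mk (l :: ls)) =
      ∫ Q, normWilson Q l * normProd Q (reps ls) ∂(gaugeMeasure Λ N β) := by
    intro l
    rw [wilsonPhi_mk hN]
    simp only [List.map_cons, List.prod_cons, prod_map_normWilson]
  have f2 : ∀ l l' : Loop d, wilsonPhi Λ N β (.mk (l :: l' :: ls)) =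
      ∫ Q, normWilson Q l * normWilson Q l' * normProd Q (reps ls) ∂(gaugeMeasure Λ N β) := by
    intro l l'
    rw [wilsonPhi_mk hN]
    simp only [List.map_cons, List.prod_cons, prod_map_normWilson, mul_assoc]
  have hl' : ∀ Q : Config Λ N, normTrace Q ρ = normWilson Q l₁ := by
    intro Q
    rw [normWilson, wilson_eq hl]
    rfl
  simp only [sdTerm_eq hρ hx hΛ, hl']
  simp only [add_mul, sub_mul, neg_mul, Finset.sum_mul, mul_assoc β]
  rw [integral_add, integral_add, integral_sub, integral_neg, integral_finsetSum,
    integral_finsetSum, integral_const_mul, integral_finsetSum]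
  · unfold locTerm
    simp only [f1, f2]
    congr 2
    refine Finset.sum_congr rfl fun p _ => ?_
    rw [integral_sub (i1 _) (i1 _)]
  · exact fun p _ => (i1 _).sub (i1 _)
  · exact fun p _ => i2 _ _
  · exact fun p _ => i2 _ _
  · exact (i1 _).neg
  · exact integrable_finsetSum _ fun p _ => i2 _ _
  · exact (i1 _).neg.sub (integrable_finsetSum _ fun p _ => i2 _ _)
  · exact integrable_finsetSum _ fun p _ => i2 _ _
  · exact ((i1 _).neg.sub (integrable_finsetSum _ fun p _ => i2 _ _)).add
      (integrable_finsetSum _ fun p _ => i2 _ _)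
  · exact (integrable_finsetSum _ fun p _ => (i1 _).sub (i1 _)).const_mul _

/-! ### The limit -/

theorem tendsto_locTerm {F : Filter ℕ} {f : ℕ → LoopSeq d → ℝ} {φ : LoopSeq d → ℝ}
    (h : ∀ s, Tendsto (fun n => f n s) F (𝓝 (φ s))) (β : ℝ) (l₁ : Loop d) (ρ : List (Edge d))
    (e : Edge d) (ls : List (Loop d)) (x : ℕ) :
    Tendsto (fun n => locTerm β (f n) l₁ ρ e ls x) F (𝓝 (locTerm β φ l₁ ρ e ls x)) :=
  ((((h _).neg.sub (tendsto_finsetSum _ fun _ _ => h _)).add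
    (tendsto_finsetSum _ fun _ _ => h _)).add
      ((tendsto_finsetSum _ fun _ _ => (h _).sub (h _)).const_mul β))

theorem eventually_subset {Λ : ℕ → Finset (Fin d → ℤ)} (hm : Monotone Λ)
    (hΛ : ∀ x, ∃ N, x ∈ Λ N) (S : Finset (Fin d → ℤ)) : ∀ᶠ N in atTop, S ⊆ Λ N := by
  have h : ∀ x ∈ S, ∀ᶠ N in atTop, x ∈ Λ N := by
    intro x _
    obtain ⟨n, hn⟩ := hΛ x
    exact eventually_atTop.mpr ⟨n, fun N hN => hm hN hn⟩
  exact (Finset.eventually_all S).mpr h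

theorem eventually_plaquettesAt_subset {Λ : ℕ → Finset (Fin d → ℤ)} (hm : Monotone Λ)
    (hΛ : ∀ x, ∃ N, x ∈ Λ N) (e : Edge d) :
    ∀ᶠ N in atTop, plaquettesAt e ⊆ plaquettesIn (Λ N) := by
  have hS := eventually_subset hm hΛ
    (Finset.Icc (fun i => e.src i - 5) (fun i => e.src i + 5))
  filter_upwards [hS] with N hN p hp
  refine mem_plaquettesIn.mpr ⟨(mem_plaquettesAt.mp hp).1, fun f hf => ?_⟩
  have h := plaquettesAt_near hp f hf
  constructor <;> refine hN (Finset.mem_Icc.mpr ⟨fun i => ?_, fun i => ?_⟩) <;>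
    have := h i <;> dsimp only <;> omega

/-- Compactness of [−1, 1] gives the pointwise limits, and the integration by parts passes to them.
The limit does not depend on a first edge rule, because the equation holds separately at every
location of every representing path. -/
theorem exists_ultrafilter_limit {Λ : ℕ → Finset (Fin d → ℤ)} (hm : Monotone Λ)
    (hΛ : ∀ x, ∃ N, x ∈ Λ N) (β : ℝ) (U : Ultrafilter ℕ) (hU : (U : Filter ℕ) ≤ atTop) :
    ∃ φ : LoopSeq d → ℝ, (∀ R : FirstEdgeRule d, IsMasterSolution R 1 β φ) ∧
      ∀ s, Tendsto (fun N => wilsonPhi (Λ N) N β s) U (𝓝 (φ s)) := by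
  have hpos : ∀ᶠ N in (U : Filter ℕ), 0 < N := hU (eventually_gt_atTop 0)
  have hlim : ∀ s : LoopSeq d, ∃ a ∈ Set.Icc (-1 : ℝ) 1,
      Tendsto (fun N => wilsonPhi (Λ N) N β s) U (𝓝 a) := by
    intro s
    refine isCompact_Icc.ultrafilter_le_nhds (U.map fun N => wilsonPhi (Λ N) N β s) ?_
    rw [le_principal_iff]
    change ∀ᶠ N in (U : Filter ℕ), wilsonPhi (Λ N) N β s ∈ Set.Icc (-1 : ℝ) 1
    filter_upwards [hpos] with N hN
    exact abs_le.mp (abs_wilsonPhi_le_one hN β s)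
  choose φ hφ1 hφ2 using hlim
  refine ⟨φ, fun R => ⟨?_, ?_, ?_⟩, hφ2⟩
  · refine tendsto_nhds_unique (hφ2 _) (tendsto_const_nhds.congr' ?_)
    filter_upwards [hpos] with N hN
    rw [wilsonPhi_null hN]
  · intro s
    rw [one_pow]
    exact abs_le.mpr (hφ1 s)
  · intro s l₁ ls hs e τ hρ
    have key : ∀ (f : Edge d) (x : ℕ), x ∈ locs (R.path l₁) f →
        locTerm β φ l₁ (R.path l₁) f ls x = 0 := by
      intro f x hx
      refine tendsto_nhds_unique (tendsto_locTerm hφ2 β l₁ (R.path l₁) f ls x) ?_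
      set σ := after (R.path l₁) x ++ before (R.path l₁) x
      have hC : Tendsto (fun N : ℕ => (2 * ((σ.length : ℝ) + 1) +
          4 * (((reps ls).map List.length).sum : ℝ)) / N) U (𝓝 0) :=
        (tendsto_const_div_atTop_nhds_zero_nat _).mono_left hU
      refine squeeze_zero_norm' ?_ hC
      -- For large N the edge and all plaquettes at it lie in Λ_N, so the identity holds up to the
      -- error of order 1/N, whose numerator is independent of N.
      filter_upwards [hpos, hU (eventually_plaquettesAt_subset hm hΛ f),
        hU (eventually_subset hm hΛ {f.src, f.tgt})] with N h1 h2 h3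
      rw [locTerm_wilsonPhi h1 (R.path_mem l₁) (mem_locs.mp hx) h2]
      exact abs_integral_sdTerm_le h1 (h3 (by simp)) (h3 (by simp)) β _ _
    have h := sum_locTerm β φ l₁ (R.path l₁) e ls
    rw [Finset.sum_eq_zero (key e), Finset.sum_eq_zero (key e.inv), ← hs, LoopSeq.mk_minRep] at h
    linarith

/-- Boxes. -/
noncomputable def box (d : ℕ) (N : ℕ) : Finset (Fin d → ℤ) := Finset.Icc (fun _ => -(N : ℤ)) (fun _ => N)

theorem box_mono (d : ℕ) : Monotone (box d) := by
  intro m n h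
  refine Finset.Icc_subset_Icc (fun i => ?_) (fun i => ?_) <;> dsimp only <;> omega

theorem exists_mem_box (x : Fin d → ℤ) : ∃ N, x ∈ box d N := by
  refine ⟨∑ i, (x i).natAbs, Finset.mem_Icc.mpr ⟨fun i => ?_, fun i => ?_⟩⟩ <;>
  · have := Finset.single_le_sum (f := fun i => (x i).natAbs) (fun _ _ => Nat.zero_le _)
      (Finset.mem_univ i)
    dsimp only at this ⊢
    omega

theorem exists_firstEdgeRule (d : ℕ) : Nonempty (FirstEdgeRule d) :=
  ⟨⟨fun l => Quotient.out l.1, fun _ => Quotient.out_eq _⟩⟩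

theorem IsMasterSolution.mono {R : FirstEdgeRule d} {β L : ℝ} {φ : LoopSeq d → ℝ}
    (h : IsMasterSolution R 1 β φ) (hL : 1 ≤ L) : IsMasterSolution R L β φ where
  null := h.null
  bound s := (h.bound s).trans (by rw [one_pow]; exact one_le_pow₀ hL)
  master := h.master

end LatticeGauge

/-! ### Existence, uniqueness and convergence combined -/

open LatticeGauge
theorem mainTheorem4 (d : ℕ) (hd : 2 ≤ d) :
    (∀ L : ℝ, 1 ≤ L → ∃ β₀ : ℝ, 0 < β₀ ∧ ∀ β : ℝ, |β| ≤ β₀ →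
      ∀ R : FirstEdgeRule d, ∃! φ : LoopSeq d → ℝ, IsMasterSolution R L β φ) ∧
    (∃ β₀ : ℝ, 0 < β₀ ∧ ∀ β : ℝ, |β| ≤ β₀ →
      ∃ φ : LoopSeq d → ℝ, (∀ R : FirstEdgeRule d, IsMasterSolution R 1 β φ) ∧
        ∀ Λ : ℕ → Finset (Fin d → ℤ), Monotone Λ → (∀ x, ∃ N, x ∈ Λ N) →
          ∀ s : LoopSeq d, Tendsto (fun N => wilsonPhi (Λ N) N β s) atTop (𝓝 (φ s))) := by
  -- Any exhaustion and any free ultrafilter will do for existence; boxes are used.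
  have hex : ∀ β : ℝ, ∃ φ : LoopSeq d → ℝ, ∀ R : FirstEdgeRule d, IsMasterSolution R 1 β φ :=
    fun β => (exists_ultrafilter_limit (box_mono d) exists_mem_box β (hyperfilter ℕ)
      (Nat.hyperfilter_le_atTop)).imp fun _ h => h.1
  refine ⟨fun L hL => ?_, ?_⟩
  · obtain ⟨β₀, h0, h⟩ := exists_unique_bound d hL
    refine ⟨β₀, h0, fun β hβ R => ?_⟩
    obtain ⟨φ, hφ⟩ := hex β
    exact ⟨φ, (hφ R).mono hL, fun ψ hψ => h β hβ R ψ φ hψ ((hφ R).mono hL)⟩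
  · obtain ⟨β₀, h0, h⟩ := exists_unique_bound d le_rfl
    obtain ⟨R⟩ := exists_firstEdgeRule d
    refine ⟨β₀, h0, fun β hβ => ?_⟩
    obtain ⟨φ, hφ⟩ := hex β
    -- Convergence is tested on ultrafilters: each one finer than `atTop` yields some limit solution
    -- for the given exhaustion, which uniqueness with L = 1, for one arbitrary rule, identifies
    -- with φ.
    refine ⟨φ, hφ, fun Λ hm hΛ s => (tendsto_iff_ultrafilter _ _ _).mpr fun U hU => ?_⟩
    obtain ⟨ψ, hψ, hlim⟩ := exists_ultrafilter_limit hm hΛ β U hU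
    rw [h β hβ R φ ψ (hφ R) (hψ R)]
    exact hlim s
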